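/- Let $n\ge 1$ and $r\ge 1$ be integers, let $u_1,\dots,u_r$ be distinct complex numbers, and put $P_k(X)=\prod_{l\neq k}\frac{X-u_l}{u_k-u_l}$ for $1\le k\le r$. Let $\mathcal H_{n,r}(0)$ be the associative unital $\mathbb C$-algebra generated by $T_1,\dots,T_{n-1},\xi_1,\dots,\xi_n$ subject to \begin{gather*} T_i(T_i+1)=0,\qquad T_iT_{i+1}T_i=T_{i+1}T_iT_{i+1},\qquad T_iT_j=T_jT_i\ (|i-j|\ge 2),\\ (\xi_j-u_1)\cdots(\xi_j-u_r)=0,\qquad \xi_i\xi_j=\xi_j\xi_i,\\ T_i\xi_i=\xi_{i+1}T_i+\sum_{c_1<c_2}(u_{c_2}-u_{c_1})P_{c_1}(\xi_i)P_{c_2}(\xi_{i+1}),\\ T_i(\xi_{i+1}+\xi_i)=(\xi_{i+1}+\xi_i)T_i,\qquad T_i\xi_j=\xi_jT_i\ (j\neq i,i+1). \end{gather*} For a permutation $\sigma\in\mathfrak S_n$ with reduced word $i_1\cdots i_k$ put $T_\sigma=T_{i_1}\cdots T_{i_k}$ and $\square_\sigma=(1+T_{i_1})\cdots(1+T_{i_k})$.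 For a composition $I=(i_1,\dots,i_k)$ of $n$ let $D(I)=\{i_1,i_1+i_2,\dots,i_1+\cdots+i_{k-1}\}$ be its descent set, let $\bar I=(i_k,\dots,i_1)$, let $w_{\bar I}$ be the longest element of the Young subgroup $\mathfrak S_{i_k}\times\cdots\times\mathfrak S_{i_1}$ of $\mathfrak S_n$, let $w_0$ be the longest element of $\mathfrak S_n$, and put $\eta_I=T_{w_0w_{\bar I}}\,\square_{w_{\bar I}}$; this is the standard generator of the simple module of the $0$-Hecke algebra $H_n(0)$ on which $T_i$ acts by $-1$ if $i\in D(I)$ and by $0$ otherwise. A colored ribbon $[I,\mathbf c]$ consists of a composition $I$ of $n$ and a word $\mathbf c=(c_1,\dots,c_n)\in\{1,\dots,r\}^n$. It is a cycloribbon if, for $1\le i\le n-1$, $c_i\le c_{i+1}$ when $i\notin D(I)$ and $c_i\ge c_{i+1}$ when $i\in D(I)$. Let $\phi([I,\mathbf c])=[J,\mathbf c]$, where $i\in D(J)$ if and only if either $c_i=c_{i+1}$ and $i\in D(I)$, or $c_i\ne c_{i+1}$ and $i\notin D(I)$. For a cycloribbon $[I,\mathbf c]$ put $$\eta_{[I,\mathbf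 c]}=P_{c_1}(\xi_1)\cdots P_{c_n}(\xi_n)\,\eta_I .$$ Then: (1) For every cycloribbon $[I,\mathbf c]$, the left ideal $S_{[I,\mathbf c]}=\mathcal H_{n,r}(0)\,\eta_{[I,\mathbf c]}$ is a minimal left ideal, hence a simple module, and has dimension $1$ over $\mathbb C$. On it $\xi_j$ acts by the scalar $u_{c_j}$ $(1\le j\le n)$, and $T_i$ $(1\le i\le n-1)$ acts by $-1$ if $i$ is a descent of the shape of $\phi([I,\mathbf c])$, and by $0$ otherwise. (2) If $S_{[I,\mathbf c]}\cong S_{[J,\mathbf d]}$ for cycloribbons $[I,\mathbf c]$ and $[J,\mathbf d]$, then $[I,\mathbf c]=[J,\mathbf d]$. (3) Every simple left $\mathcal H_{n,r}(0)$-module is one-dimensional over $\mathbb C$ and isomorphic to $S_{[I,\mathbf c]}$ for some cycloribbon $[I,\mathbf c]$. (4) There are exactly $r(r+1)^{n-1}$ isomorphism classes of simple left $\mathcal H_{n,r}(0)$-modules. -/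

import Mathlib

universe v w

noncomputable section

namespace AKS

open Polynomial

/-! ### The Ariki-Koike-Shoji algebra

Indices are `0`-based: `T_1, …, T_{n-1}` is indexed by `Fin (n - 1)`, `ξ_1, …, ξ_n` by `Fin n`, and
the color set by `Fin r`.  The position `i : Fin (n - 1)` has the two neighbouring cells
`lo i` (number `i`) and `hi i` (number `i + 1`). -/

def lo {n : ℕ} (i : Fin (n - 1)) : Fin n := ⟨i, by omega⟩

def hi {n : ℕ} (i : Fin (n - 1)) : Fin n := ⟨i + 1, by omega⟩

/-- `P_k(X) = ∏_{l ≠ k} (X - u_l) / (u_k - u_l)`, evaluated at an element of a `ℂ`-algebra. -/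
def lagr {r : ℕ} (u : Fin r → ℂ) {A : Type*} [Ring A] [Algebra ℂ A] (k : Fin r) (x : A) : A :=
  aeval x (Lagrange.basis Finset.univ u k)

/-- The free algebra on the symbols `T_i` and `ξ_j`. -/
abbrev Free (n : ℕ) : Type := FreeAlgebra ℂ (Fin (n - 1) ⊕ Fin n)

def fT {n : ℕ} (i : Fin (n - 1)) : Free n := FreeAlgebra.ι ℂ (Sum.inl i)

def fξ {n : ℕ} (j : Fin n) : Free n := FreeAlgebra.ι ℂ (Sum.inr j)

/-- The defining relations, for the parameter `q`. -/
inductive Rel (n r : ℕ) (u : Fin r → ℂ) (q : ℂ) : Free n → Free n → Prop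
  | quadratic (i : Fin (n - 1)) :
      Rel n r u q ((fT i - algebraMap ℂ (Free n) q) * (fT i + 1)) 0
  | braid (i j : Fin (n - 1)) (h : (j : ℕ) = i + 1) :
      Rel n r u q (fT i * fT j * fT i) (fT j * fT i * fT j)
  | T_comm (i j : Fin (n - 1)) (h : (i : ℕ) + 2 ≤ j) :
      Rel n r u q (fT i * fT j) (fT j * fT i)
  | annihilate (j : Fin n) :
      Rel n r u q (aeval (fξ j) (∏ l, (X - C (u l)))) 0
  | ξ_comm (i j : Fin n) :
      Rel n r u q (fξ i * fξ j) (fξ j * fξ i)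
  | exchange (i : Fin (n - 1)) :
      Rel n r u q (fT i * fξ (lo i))
        (fξ (hi i) * fT i - (q - 1) •
          ∑ a : Fin r, ∑ b : Fin r, if a < b then
            (u b - u a) • (lagr u a (fξ (lo i)) * lagr u b (fξ (hi i))) else 0)
  | sum_comm (i : Fin (n - 1)) :
      Rel n r u q (fT i * (fξ (hi i) + fξ (lo i))) ((fξ (hi i) + fξ (lo i)) * fT i)
  | T_ξ_comm (i : Fin (n - 1)) (j : Fin n) (h₁ : j ≠ lo i) (h₂ : j ≠ hi i) :
      Rel n r u q (fT i * fξ j) (fξ j * fT i)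

/-- The Ariki-Koike-Shoji algebra `H_{n,r}(q)`. -/
abbrev Alg (n r : ℕ) (u : Fin r → ℂ) (q : ℂ) : Type := RingQuot (Rel n r u q)

/-- The `0`-Ariki-Koike-Shoji algebra `H_{n,r}(0)`. -/
abbrev H (n : ℕ) {r : ℕ} (u : Fin r → ℂ) : Type := Alg n r u 0

variable {n r : ℕ}

def T (u : Fin r → ℂ) (i : Fin (n - 1)) : H n u := RingQuot.mkAlgHom ℂ (Rel n r u 0) (fT i)

def ξ (u : Fin r → ℂ) (j : Fin n) : H n u := RingQuot.mkAlgHom ℂ (Rel n r u 0) (fξ j)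

/-- `L_c = P_{c_1}(ξ_1) ⋯ P_{c_n}(ξ_n)`. -/
def L (u : Fin r → ℂ) (c : Fin n → Fin r) : H n u :=
  (List.ofFn fun j => lagr u (c j) (ξ u j)).prod

/-! ### Reduced words and the elements `T_σ` -/

/-- The elementary transposition exchanging the positions `lo i` and `hi i`. -/
def sref (i : Fin (n - 1)) : Equiv.Perm (Fin n) := Equiv.swap (lo i) (hi i)

/-- `w` is a reduced word of the permutation `σ`. -/
def IsReducedWord (w : List (Fin (n - 1))) (σ : Equiv.Perm (Fin n)) : Prop :=
  (w.map sref).prod = σ ∧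
    ∀ w' : List (Fin (n - 1)), (w'.map sref).prod = σ → w.length ≤ w'.length

theorem exists_word (σ : Equiv.Perm (Fin n)) :
    ∃ w : List (Fin (n - 1)), (w.map sref).prod = σ := by
  cases n with
  | zero => exact ⟨[], Subsingleton.elim _ _⟩
  | succ m =>
    have hσ : σ ∈ Submonoid.closure (Set.range fun i : Fin m => Equiv.swap i.castSucc i.succ) := by
      rw [Equiv.Perm.mclosure_swap_castSucc_succ]; trivial
    induction hσ using Submonoid.closure_induction with
    | mem x hx =>
      obtain ⟨i, rfl⟩ := hx
      exact ⟨[i], by simp [sref]; rfl⟩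
    | one => exact ⟨[], rfl⟩
    | mul x y _ _ hx hy =>
      obtain ⟨a, rfl⟩ := hx
      obtain ⟨b, rfl⟩ := hy
      exact ⟨a ++ b, by simp⟩

theorem exists_reducedWord (σ : Equiv.Perm (Fin n)) :
    ∃ w : List (Fin (n - 1)), IsReducedWord w σ := by
  have h : {w : List (Fin (n - 1)) | (w.map sref).prod = σ}.Nonempty := exists_word σ
  refine ⟨Function.argminOn List.length _ h, Function.argminOn_mem List.length _ h, ?_⟩
  intro w' hw'
  exact Function.argminOn_le List.length _ hw'

/-- A reduced word of `σ`. -/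
def reducedWord (σ : Equiv.Perm (Fin n)) : List (Fin (n - 1)) := (exists_reducedWord σ).choose

/-- `T_σ = T_{i_1} ⋯ T_{i_k}` for a reduced word `i_1 … i_k` of `σ`. -/
def Tperm (u : Fin r → ℂ) (σ : Equiv.Perm (Fin n)) : H n u :=
  ((reducedWord σ).map fun i => T u i).prod

/-- `□_σ = □_{i_1} ⋯ □_{i_k}` for a reduced word `i_1 … i_k` of `σ`, where `□_i = 1 + T_i`. -/
def Sqperm (u : Fin r → ℂ) (σ : Equiv.Perm (Fin n)) : H n u :=
  ((reducedWord σ).map fun i => 1 + T u i).prod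

/-! ### Compositions and ribbons -/

/-- The correspondence between compositions of `n` and subsets of `{1, …, n-1}`, sending
`(i_1, …, i_k)` to its set of descents `{i_1, i_1 + i_2, …, i_1 + ⋯ + i_{k-1}}`; the descent
`d` is represented by the index `d - 1 : Fin (n - 1)`. -/
def descentEquiv (n : ℕ) : Composition n ≃ Finset (Fin (n - 1)) :=
  (compositionEquiv n).trans (compositionAsSetEquiv n)

def descents (I : Composition n) : Finset (Fin (n - 1)) := descentEquiv n I

/-- A colored ribbon `[I, c]`.  The cells `lo i` and `hi i` lie in the same column if `i` is a
descent of `I` (the second one below the first one), and in the same row otherwise. -/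
@[ext]
structure ColoredRibbon (n r : ℕ) where
  shape : Composition n
  color : Fin n → Fin r

/-- Cycloribbons: weakly increasing in rows, weakly decreasing in columns. -/
def ColoredRibbon.IsCycloribbon (R : ColoredRibbon n r) : Prop :=
  ∀ i : Fin (n - 1),
    (i ∉ descents R.shape → R.color (lo i) ≤ R.color (hi i)) ∧
    (i ∈ descents R.shape → R.color (hi i) ≤ R.color (lo i))

/-- The involution `φ` on colored ribbons: the reading is kept, and the cell `hi i` is glued to
the cell `lo i` in the same position (right or down) as in `R` if both have the same color, and
in the other position if their colors differ. -/
def ColoredRibbon.phi (R : ColoredRibbon n r) : ColoredRibbon n r where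
  shape := (descentEquiv n).symm (Finset.univ.filter fun i : Fin (n - 1) =>
    if R.color (lo i) = R.color (hi i) then i ∈ descents R.shape else i ∉ descents R.shape)
  color := R.color

/-! ### The generators of the simple modules -/

/-- The longest element of the Young subgroup `S_{i_1} × ⋯ × S_{i_k}` of `S_n`, for
`I = (i_1, …, i_k)`: it reverses each block of consecutive positions. -/
def youngLongest (I : Composition n) : Equiv.Perm (Fin n) :=
  I.blocksFinEquiv.permCongr (Equiv.sigmaCongrRight fun _ => Fin.revPerm)

/-- The standard generator `η_I = T_{ω(Ī)} □_{α(I~)}` of the simple `H_n(0)`-module indexed by `I`,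
on which `T_i` acts by `-1` if `i` is a descent of `I` and by `0` otherwise.  Here `Ī` is the mirror
image of `I`, and `I~` its conjugate, `α(I~)` is the shortest permutation of descent composition
`I~`, which is the longest element of the Young subgroup of `Ī`, and `ω(Ī)` is the longest
permutation of descent composition `Ī`, which is `w₀ α(I~)`. -/
def etaHecke (u : Fin r → ℂ) (I : Composition n) : H n u :=
  Tperm u (Fin.revPerm * youngLongest I.reverse) * Sqperm u (youngLongest I.reverse)

/-- `η_{[I, c]} = L_c η_I`. -/
def eta (u : Fin r → ℂ) (R : ColoredRibbon n r) : H n u :=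
  L u R.color * etaHecke u R.shape

/-- The left ideal `S_{[I, c]} = H_{n,r}(0) η_{[I, c]}`. -/
def S (u : Fin r → ℂ) (R : ColoredRibbon n r) : Submodule (H n u) (H n u) :=
  Submodule.span (H n u) {eta u R}

/-! ### Isomorphism classes of simple modules -/

def simpleSetoid (A : Type w) [Ring A] : Setoid {M : ModuleCat.{v} A // IsSimpleModule A M} where
  r M N := Nonempty (M.1 ≃ₗ[A] N.1)
  iseqv :=
    { refl := fun M => ⟨LinearEquiv.refl A M.1⟩
      symm := fun ⟨e⟩ => ⟨e.symm⟩
      trans := fun ⟨e⟩ ⟨f⟩ => ⟨e.trans f⟩ }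

/-- Isomorphism classes of simple left `A`-modules. -/
def SimpleClass (A : Type w) [Ring A] : Type (max (v + 1) w) :=
  Quotient (simpleSetoid.{v, w} A)

end AKS

end

namespace AKS

open Polynomial Finset

variable {n r : ℕ}

/-! ### Inversions and Coxeter length -/

/-! The `L u c` are orthogonal idempotents with sum `1`, and `ξ u j` acts on `L u c` by `u (c j)`.
Comparing the two sides of the exchange relation between such idempotents yields the rules that
carry the proof (`T_mul_L_of_eq`, `T_mul_L_of_ne`). With `s = sref i`, `T_i L_c` equals `L_c T_i` if
the two colors at `i` agree, `L_{cs} T_i - L_c` if they increase, and `L_{cs} T_i + L_{cs}` if they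
decrease.

Let `m` be a vector on which `T_i` acts by `-1` for `i ∈ D(I)` and by `0` otherwise. If `[I, c]` is
a cycloribbon, the `L_{cs}` terms vanish or cancel, so `L_c m` is a common eigenvector whose sign at
`i` is switched exactly where the colors differ: this is `φ` (`isEigen_L_smul`). The vector `η_I` is
such an `m`, by Matsumoto's theorem (`Braided.word_eq`) and the combinatorics of longest elements.

That `L_c η_I ≠ 0` is seen in a representation on functions of colorings with values in a 0-Hecke
module, where `L_c` preserves the value at `c` and constant functions copy the 0-Hecke module
(`eta_ne_zero`).

Conversely, two extremal choices produce a common eigenvector in every nonzero module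
(`exists_isEigen`). The rules force its eigenvalues to come from a cycloribbon, and the eigenvalues
determine both the cyclic module and the ribbon. Counting classes then means counting cycloribbons.
-/

theorem lo_ne_hi (i : Fin (n - 1)) : lo i ≠ hi i := by
  simp [lo, hi, Fin.ext_iff]

theorem lo_lt_hi (i : Fin (n - 1)) : lo i < hi i := by
  simp [lo, hi, Fin.lt_def]

@[simp] theorem sref_lo (i : Fin (n - 1)) : sref i (lo i) = hi i := Equiv.swap_apply_left _ _

@[simp] theorem sref_hi (i : Fin (n - 1)) : sref i (hi i) = lo i := Equiv.swap_apply_right _ _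

theorem sref_of_ne (i : Fin (n - 1)) {a : Fin n} (h₁ : a ≠ lo i) (h₂ : a ≠ hi i) :
    sref i a = a := Equiv.swap_apply_of_ne_of_ne h₁ h₂

@[simp] theorem sref_sref (i : Fin (n - 1)) (a : Fin n) : sref i (sref i a) = a := by
  simp [sref]

@[simp] theorem sref_mul_self (i : Fin (n - 1)) : sref i * sref i = 1 := Equiv.swap_mul_self _ _

@[simp] theorem sref_inv (i : Fin (n - 1)) : (sref i)⁻¹ = sref i := Equiv.swap_inv _ _

@[simp] theorem sref_mul_sref_mul (i : Fin (n - 1)) (σ : Equiv.Perm (Fin n)) :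
    sref i * (sref i * σ) = σ := by rw [← mul_assoc, sref_mul_self, one_mul]

theorem sref_lt_sref (i : Fin (n - 1)) {a b : Fin n} (h : a < b) (hne : ¬ (a = lo i ∧ b = hi i)) :
    sref i a < sref i b := by
  simp only [sref, Equiv.swap_apply_def, lo, hi, Fin.lt_def, Fin.ext_iff] at *
  split_ifs <;> simp_all <;> omega

/-- The inversions of `σ⁻¹`. -/
def inversions (σ : Equiv.Perm (Fin n)) : Finset (Fin n × Fin n) :=
  univ.filter fun p => p.1 < p.2 ∧ σ⁻¹ p.2 < σ⁻¹ p.1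

/-- The number of inversions, which is the Coxeter length. -/
def len (σ : Equiv.Perm (Fin n)) : ℕ := (inversions σ).card

/-- `i` is a left descent of `σ`. -/
def LeftDescent (σ : Equiv.Perm (Fin n)) (i : Fin (n - 1)) : Prop := σ⁻¹ (hi i) < σ⁻¹ (lo i)

theorem leftDescent_sref_mul_iff (σ : Equiv.Perm (Fin n)) (i : Fin (n - 1)) :
    LeftDescent (sref i * σ) i ↔ ¬ LeftDescent σ i := by
  have : σ⁻¹ (lo i) ≠ σ⁻¹ (hi i) := fun h => lo_ne_hi i (σ⁻¹.injective h)
  simp only [LeftDescent, mul_inv_rev, sref_inv, Equiv.Perm.mul_apply, sref_lo, sref_hi, not_lt]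
  exact ⟨le_of_lt, fun h => lt_of_le_of_ne h this⟩

/-- `sref i` preserves the order of every pair except `(lo i, hi i)`, so it carries the old
inversions to new ones and exactly that one pair is added. -/
theorem len_sref_mul {σ : Equiv.Perm (Fin n)} {i : Fin (n - 1)} (h : ¬ LeftDescent σ i) :
    len (sref i * σ) = len σ + 1 := by
  have key : inversions (sref i * σ) = insert (lo i, hi i)
      ((inversions σ).map ((sref i).toEmbedding.prodMap (sref i).toEmbedding)) := by
    ext ⟨a, b⟩
    simp only [inversions, mem_filter, mem_univ, true_and, mem_insert, mem_map, Prod.exists,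
      Function.Embedding.prodMap, mul_inv_rev, sref_inv, Equiv.Perm.mul_apply]
    constructor
    · rintro ⟨h1, h2⟩
      by_cases hab : a = lo i ∧ b = hi i
      · left; rw [hab.1, hab.2]
      · right
        exact ⟨sref i a, sref i b, ⟨sref_lt_sref i h1 hab, h2⟩, by simp⟩
    · rintro (h' | ⟨c, d, ⟨h1, h2⟩, h3⟩)
      · obtain ⟨rfl, rfl⟩ := Prod.mk.inj h'
        refine ⟨lo_lt_hi i, ?_⟩
        have := (leftDescent_sref_mul_iff σ i).2 h
        simpa [LeftDescent] using this
      · obtain ⟨rfl, rfl⟩ := Prod.mk.inj h3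
        refine ⟨sref_lt_sref i h1 ?_, by simpa using h2⟩
        rintro ⟨rfl, rfl⟩
        exact h h2
  rw [len, key, card_insert_of_notMem, card_map, len]
  simp only [inversions, mem_filter, mem_univ, true_and, mem_map, Prod.exists,
      Function.Embedding.prodMap, not_exists, not_and]
  rintro a b ⟨h1, h2⟩ h3
  have ha : sref i a = lo i := (Prod.mk.inj h3).1
  have hb : sref i b = hi i := (Prod.mk.inj h3).2
  have ha' : a = hi i := by rw [← sref_sref i a, ha, sref_lo]
  have hb' : b = lo i := by rw [← sref_sref i b, hb, sref_hi]
  rw [ha', hb'] at h1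
  exact lt_asymm h1 (lo_lt_hi i)

theorem len_of_leftDescent {σ : Equiv.Perm (Fin n)} {i : Fin (n - 1)} (h : LeftDescent σ i) :
    len σ = len (sref i * σ) + 1 := by
  have : ¬ LeftDescent (sref i * σ) i := by rw [leftDescent_sref_mul_iff]; exact not_not.2 h
  simpa using len_sref_mul this

theorem len_sref_mul_le (σ : Equiv.Perm (Fin n)) (i : Fin (n - 1)) :
    len (sref i * σ) ≤ len σ + 1 := by
  by_cases h : LeftDescent σ i
  · have := len_of_leftDescent h; omega
  · exact (len_sref_mul h).le

theorem not_leftDescent_of_len {σ : Equiv.Perm (Fin n)} {i : Fin (n - 1)}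
    (h : len (sref i * σ) = len σ + 1) : ¬ LeftDescent σ i := by
  intro h'
  have := len_of_leftDescent h'
  omega

theorem leftDescent_of_len {σ : Equiv.Perm (Fin n)} {i : Fin (n - 1)}
    (h : len σ = len (sref i * σ) + 1) : LeftDescent σ i := by
  by_contra h'
  have := len_sref_mul h'
  omega

@[simp] theorem len_one : len (1 : Equiv.Perm (Fin n)) = 0 := by
  simp only [len, inversions, card_eq_zero, filter_eq_empty_iff]
  rintro p _ ⟨h1, h2⟩
  exact lt_asymm h1 h2

theorem strictMono_of_adjacent {f : Fin n → Fin n} (h : ∀ i : Fin (n - 1), f (lo i) < f (hi i)) :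
    StrictMono f := by
  cases n with
  | zero => intro a; exact a.elim0
  | succ m => exact Fin.strictMono_iff_lt_succ.2 fun i => h i

/-- Without descents `σ⁻¹` is strictly increasing, and `Fin n` has only one order automorphism. -/
theorem exists_leftDescent {σ : Equiv.Perm (Fin n)} (h : σ ≠ 1) : ∃ i, LeftDescent σ i := by
  by_contra! hc
  apply h
  have hm : StrictMono (σ⁻¹ : Equiv.Perm (Fin n)) := by
    apply strictMono_of_adjacent
    intro i
    refine lt_of_le_of_ne (not_lt.1 (hc i)) fun h => lo_ne_hi i (σ⁻¹.injective h)
  have : (⇑(σ⁻¹ : Equiv.Perm (Fin n))) = id := by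
    have := Subsingleton.elim (hm.orderIsoOfSurjective _ (σ⁻¹).surjective) (OrderIso.refl (Fin n))
    funext a
    exact congrArg (fun e : Fin n ≃o Fin n => e a) this
  have h1 : (σ⁻¹ : Equiv.Perm (Fin n)) = 1 := Equiv.ext fun a => congrFun this a
  exact inv_eq_one.1 h1

theorem len_le_length (w : List (Fin (n - 1))) : len (w.map sref).prod ≤ w.length := by
  induction w with
  | nil => simp
  | cons i w ih =>
    simp only [List.map_cons, List.prod_cons, List.length_cons]
    exact (len_sref_mul_le _ _).trans (by omega)

theorem exists_word_len (σ : Equiv.Perm (Fin n)) :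
    ∃ w : List (Fin (n - 1)), (w.map sref).prod = σ ∧ w.length = len σ := by
  induction h : len σ generalizing σ with
  | zero =>
    by_cases h1 : σ = 1
    · exact ⟨[], by simp [h1], by simp⟩
    · obtain ⟨i, hi⟩ := exists_leftDescent h1
      have := len_of_leftDescent hi
      omega
  | succ k ih =>
    have h1 : σ ≠ 1 := by rintro rfl; simp at h
    obtain ⟨i, hi⟩ := exists_leftDescent h1
    have := len_of_leftDescent hi
    obtain ⟨w, hw, hl⟩ := ih (sref i * σ) (by omega)
    exact ⟨i :: w, by simp [hw], by simp [hl]⟩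

theorem reducedWord_prod (σ : Equiv.Perm (Fin n)) : ((reducedWord σ).map sref).prod = σ :=
  (exists_reducedWord σ).choose_spec.1

theorem reducedWord_length (σ : Equiv.Perm (Fin n)) : (reducedWord σ).length = len σ := by
  obtain ⟨w, hw, hl⟩ := exists_word_len σ
  apply le_antisymm
  · rw [← hl]
    exact (exists_reducedWord σ).choose_spec.2 w hw
  · have := len_le_length (reducedWord σ)
    rwa [reducedWord_prod] at this

/-- Reversal turns inversions into non-inversions. Hence the words defining the two factors of
`etaHecke` have total length that of the longest element, which the nonvanishing proof needs. -/
theorem len_revPerm_mul (σ : Equiv.Perm (Fin n)) :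
    len (Fin.revPerm * σ) + len σ = len (Fin.revPerm : Equiv.Perm (Fin n)) := by
  have h1 : len (Fin.revPerm * σ) = (univ.filter fun p : Fin n × Fin n =>
      p.1 < p.2 ∧ ¬ σ⁻¹ p.2 < σ⁻¹ p.1).card := by
    refine card_bij (fun p _ => (Fin.rev p.2, Fin.rev p.1)) ?_ ?_ ?_
    · rintro ⟨a, b⟩ h
      simp only [inversions, mem_filter, mem_univ, true_and, mul_inv_rev, Equiv.Perm.mul_apply,
        Fin.rev_lt_rev] at h ⊢
      exact ⟨h.1, not_lt.2 (le_of_lt h.2)⟩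
    · rintro ⟨a, b⟩ _ ⟨c, d⟩ _ h
      simp only [Prod.mk.injEq, Fin.rev_inj] at h
      exact Prod.ext h.2 h.1
    · rintro ⟨a, b⟩ h
      refine ⟨(Fin.rev b, Fin.rev a), ?_, by simp⟩
      simp only [inversions, mem_filter, mem_univ, true_and, mul_inv_rev, Equiv.Perm.mul_apply,
        Fin.rev_lt_rev] at h ⊢
      refine ⟨h.1, ?_⟩
      have e : ∀ x : Fin n, (Fin.revPerm⁻¹ : Equiv.Perm (Fin n)) (Fin.rev x) = x := fun x => by
        rw [Equiv.Perm.inv_def]; simp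
      rw [e, e]
      exact lt_of_le_of_ne (not_lt.1 h.2) fun hh => h.1.ne (σ⁻¹.injective hh)
  have h2 : len (Fin.revPerm : Equiv.Perm (Fin n)) = (univ.filter fun p : Fin n × Fin n =>
      p.1 < p.2).card := by
    rw [len, inversions]
    congr 1
    ext p
    simp only [mem_filter, mem_univ, true_and, Equiv.Perm.inv_def, Fin.revPerm_symm,
      Fin.revPerm_apply, Fin.rev_lt_rev, and_self]
  rw [h1, h2, len, inversions, add_comm, ← filter_filter, ← filter_filter]
  exact card_filter_add_card_filter_not _

/-! ### Matsumoto's theorem -/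

theorem hi_eq_lo {i j : Fin (n - 1)} (h : (j : ℕ) = i + 1) : hi i = lo j := by
  simp [lo, hi, h]

theorem sref_comm {i j : Fin (n - 1)} (h : (i : ℕ) + 2 ≤ j) : sref i * sref j = sref j * sref i := by
  refine (Equiv.Perm.disjoint_swap_swap ?_).commute
  simp only [List.nodup_cons, List.mem_cons, List.not_mem_nil, or_false, not_or, lo, hi,
    Fin.ext_iff, List.nodup_nil, not_false_eq_true, and_true]
  omega

theorem sref_braid {i j : Fin (n - 1)} (h : (j : ℕ) = i + 1) :
    sref i * sref j * sref i = sref j * sref i * sref j := by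
  have h1 : lo i ≠ lo j := by simp only [lo, ne_eq, Fin.ext_iff]; omega
  have h2 : lo i ≠ hi j := by simp only [lo, hi, ne_eq, Fin.ext_iff]; omega
  rw [sref, sref, hi_eq_lo h, Equiv.swap_mul_swap_mul_swap h1 h2, Equiv.swap_comm (lo i),
    Equiv.swap_comm (lo j) (hi j), Equiv.swap_mul_swap_mul_swap (lo_ne_hi j).symm h2.symm,
    Equiv.swap_comm]

/-- The braid relations of type `A`. -/
structure Braided {A : Type*} [Monoid A] (f : Fin (n - 1) → A) : Prop where
  braid : ∀ i j : Fin (n - 1), (j : ℕ) = i + 1 → f i * f j * f i = f j * f i * f j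
  comm : ∀ i j : Fin (n - 1), (i : ℕ) + 2 ≤ j → f i * f j = f j * f i

/-- Induction on length. If the words start with `i ≠ j`, both are left descents of `σ`, so the
longest element of the subgroup generated by `s_i, s_j` can be split off on the left. Each word is
compared, after its first letter, with a word starting with that element, and one braid or
commutation relation joins the two. -/
theorem Braided.word_eq {A : Type*} [Monoid A] {f : Fin (n - 1) → A} (hf : Braided f)
    {w w' : List (Fin (n - 1))} (h : (w.map sref).prod = (w'.map sref).prod)
    (hw : w.length = len (w.map sref).prod) (hw' : w'.length = len (w.map sref).prod) :
    (w.map f).prod = (w'.map f).prod := by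
  induction hk : w.length using Nat.strong_induction_on generalizing w w' with
  | _ k ih =>
  match w, w' with
  | [], [] => rfl
  | [], j :: b => simp at hw'
  | i :: a, [] =>
    rw [← hw'] at hw
    simp at hw
  | i :: a, j :: b =>
    simp only [List.map_cons, List.prod_cons, List.length_cons] at *
    set σ := sref i * (a.map sref).prod with hσ
    have ha : (a.map sref).prod = sref i * σ := by simp [hσ]
    have hb : (b.map sref).prod = sref j * σ := by simp [h]
    clear_value σ
    have la := len_le_length a
    have lb := len_le_length b
    have di : LeftDescent σ i := by
      apply leftDescent_of_len
      rw [ha] at la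
      have := len_sref_mul_le (sref i * σ) i
      simp only [sref_mul_sref_mul] at this
      omega
    have dj : LeftDescent σ j := by
      apply leftDescent_of_len
      rw [hb] at lb
      have := len_sref_mul_le (sref j * σ) j
      simp only [sref_mul_sref_mul] at this
      omega
    have li := len_of_leftDescent di
    have lj := len_of_leftDescent dj
    have main : ∀ {i j : Fin (n - 1)} {a b : List (Fin (n - 1))}, (i : ℕ) < j →
        (a.map sref).prod = sref i * σ → (b.map sref).prod = sref j * σ →
        a.length + 1 = len σ → b.length + 1 = len σ → LeftDescent σ i → LeftDescent σ j →
        f i * (a.map f).prod = f j * (b.map f).prod := by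
      intro i j a b hij ha hb hal hbl di dj
      have li := len_of_leftDescent di
      have lj := len_of_leftDescent dj
      by_cases hfar : (i : ℕ) + 2 ≤ j
      · have dji : LeftDescent (sref i * σ) j := by
          unfold LeftDescent at *
          rw [mul_inv_rev, sref_inv, Equiv.Perm.mul_apply, Equiv.Perm.mul_apply, sref_of_ne,
            sref_of_ne]
          · exact dj
          all_goals simp only [lo, hi, ne_eq, Fin.ext_iff]; omega
        have lji := len_of_leftDescent dji
        obtain ⟨c, hc, hcl⟩ := exists_word_len (sref j * (sref i * σ))
        have e1 : (a.map f).prod = ((j :: c).map f).prod := by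
          refine ih a.length (by omega) ?_ ?_ ?_ rfl
          · simp [ha, hc]
          · rw [ha]; omega
          · rw [ha, List.length_cons]; omega
        have e2 : (b.map f).prod = ((i :: c).map f).prod := by
          have : sref j * σ = sref i * (c.map sref).prod := by
            rw [hc, ← mul_assoc, ← mul_assoc, sref_comm hfar, mul_assoc (sref j), sref_mul_self,
              mul_one]
          refine ih b.length (by omega) ?_ ?_ ?_ rfl
          · rw [hb, this, List.map_cons, List.prod_cons]
          · rw [hb]; omega
          · rw [hb, List.length_cons]; omega
        rw [e1, e2]
        simp only [List.map_cons, List.prod_cons, ← mul_assoc, hf.comm i j hfar]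
      · have hj : (j : ℕ) = i + 1 := by omega
        have hadj := hi_eq_lo hj
        have n1 : hi j ≠ lo i := by simp only [lo, hi, ne_eq, Fin.ext_iff]; omega
        have n2 : hi j ≠ hi i := by simp only [hi, ne_eq, Fin.ext_iff]; omega
        have n3 : lo i ≠ lo j := by simp only [lo, ne_eq, Fin.ext_iff]; omega
        -- The two descents give `σ⁻¹ (hi j) < σ⁻¹ (lo j) = σ⁻¹ (hi i) < σ⁻¹ (lo i)`: three
        -- positions in fully reversed order, so `s_i`, `s_j`, `s_i` can be removed in turn.
        have dji : LeftDescent (sref i * σ) j := by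
          unfold LeftDescent at *
          rw [mul_inv_rev, sref_inv, Equiv.Perm.mul_apply, Equiv.Perm.mul_apply, sref_of_ne i n1 n2,
            ← hadj, sref_hi]
          rw [hadj] at di
          exact dj.trans di
        have diji : LeftDescent (sref j * (sref i * σ)) i := by
          unfold LeftDescent at *
          simp only [mul_inv_rev, sref_inv, Equiv.Perm.mul_apply]
          rw [hadj, sref_lo, sref_of_ne i n1 n2, sref_of_ne j n3 n1.symm, sref_lo, hadj]
          exact dj
        have lji := len_of_leftDescent dji
        have liji := len_of_leftDescent diji
        obtain ⟨c, hc, hcl⟩ := exists_word_len (sref i * (sref j * (sref i * σ)))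
        have e1 : (a.map f).prod = ((j :: i :: c).map f).prod := by
          refine ih a.length (by omega) ?_ ?_ ?_ rfl
          · simp [ha, hc]
          · rw [ha]; omega
          · rw [ha, List.length_cons, List.length_cons]; omega
        have e2 : (b.map f).prod = ((i :: j :: c).map f).prod := by
          have : sref j * σ = sref i * (sref j * (c.map sref).prod) := by
            have hbr := sref_braid hj
            rw [hc, ← mul_assoc (sref i) (sref j), ← mul_assoc (sref i * sref j), hbr]
            simp [mul_assoc]
          refine ih b.length (by omega) ?_ ?_ ?_ rfl
          · rw [hb, this]; simp
          · rw [hb]; omega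
          · rw [hb, List.length_cons, List.length_cons]; omega
        rw [e1, e2]
        simp only [List.map_cons, List.prod_cons, ← mul_assoc, hf.braid i j hj]
    rcases lt_trichotomy (i : ℕ) j with hij | hij | hij
    · exact main hij ha hb (by omega) (by omega) di dj
    · obtain rfl : i = j := Fin.ext hij
      rw [ih a.length (by omega) (ha.trans hb.symm) (by rw [ha]; omega) (by rw [ha]; omega) rfl]
    · exact (main hij hb ha (by omega) (by omega) dj di).symm

/-- The product of `f` over a reduced word. -/
noncomputable def wordProd {A : Type*} [Monoid A] (f : Fin (n - 1) → A)
    (σ : Equiv.Perm (Fin n)) : A := ((reducedWord σ).map f).prod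

theorem Braided.wordProd_eq {A : Type*} [Monoid A] {f : Fin (n - 1) → A} (hf : Braided f)
    {σ : Equiv.Perm (Fin n)} {w : List (Fin (n - 1))} (h : (w.map sref).prod = σ)
    (hl : w.length = len σ) : wordProd f σ = (w.map f).prod :=
  hf.word_eq (by rw [reducedWord_prod, h]) (by rw [reducedWord_prod, reducedWord_length])
    (by rw [reducedWord_prod, hl])

theorem Braided.wordProd_sref_mul {A : Type*} [Monoid A] {f : Fin (n - 1) → A} (hf : Braided f)
    {σ : Equiv.Perm (Fin n)} {i : Fin (n - 1)} (h : ¬ LeftDescent σ i) :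
    wordProd f (sref i * σ) = f i * wordProd f σ := by
  rw [hf.wordProd_eq (w := i :: reducedWord σ) (by simp [reducedWord_prod])
    (by rw [len_sref_mul h, List.length_cons, reducedWord_length])]
  simp [wordProd]

theorem Braided.wordProd_mul_sref {A : Type*} [Monoid A] {f : Fin (n - 1) → A} (hf : Braided f)
    {σ : Equiv.Perm (Fin n)} {i : Fin (n - 1)} (h : len (σ * sref i) = len σ + 1) :
    wordProd f (σ * sref i) = wordProd f σ * f i := by
  rw [hf.wordProd_eq (w := reducedWord σ ++ [i]) (by simp [reducedWord_prod])
    (by rw [h, List.length_append, reducedWord_length]; rfl)]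
  simp [wordProd]

theorem Braided.mul_wordProd_of_leftDescent {A : Type*} [Monoid A] {f : Fin (n - 1) → A}
    (hf : Braided f) {σ : Equiv.Perm (Fin n)} {i : Fin (n - 1)} (h : LeftDescent σ i) :
    wordProd f σ = f i * wordProd f (sref i * σ) := by
  rw [← hf.wordProd_sref_mul (by rw [leftDescent_sref_mul_iff]; exact not_not.2 h),
    sref_mul_sref_mul]

/-! ### Compositions and longest elements of Young subgroups -/

/-- The index `i` stands for the cut `i + 1`, which lies strictly between `0` and `n`; the extreme
values of `k` therefore need no exclusion. -/
theorem mem_descents {I : Composition n} {i : Fin (n - 1)} :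
    i ∈ descents I ↔ ∃ k ≤ I.length, I.sizeUpTo k = i + 1 := by
  simp only [descents, descentEquiv, compositionEquiv, compositionAsSetEquiv, Equiv.trans_apply,
    Equiv.coe_fn_mk, Composition.toCompositionAsSet, Composition.boundaries, Composition.boundary,
    Set.mem_toFinset, Set.mem_ofPred_eq, mem_map, mem_univ, true_and]
  constructor
  · rintro ⟨k, hk⟩
    refine ⟨k, Nat.lt_succ_iff.1 k.2, ?_⟩
    have := congrArg Fin.val hk
    simpa [add_comm] using this
  · rintro ⟨k, hk, h⟩
    exact ⟨⟨k, Nat.lt_succ_of_le hk⟩, Fin.ext (by simpa [add_comm] using h)⟩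

theorem sizeUpTo_reverse_add (I : Composition n) (k : ℕ) :
    I.reverse.sizeUpTo k + I.sizeUpTo (I.length - k) = n := by
  conv_rhs => rw [← I.blocks_sum, ← List.sum_take_add_sum_drop I.blocks (I.length - k)]
  rw [add_comm]
  simp [Composition.sizeUpTo, Composition.reverse, List.take_reverse]

theorem mem_descents_reverse {I : Composition n} {i : Fin (n - 1)} :
    i ∈ descents I.reverse ↔ Fin.rev i ∈ descents I := by
  have key : ∀ (I : Composition n) (i : Fin (n - 1)), i ∈ descents I.reverse →
      Fin.rev i ∈ descents I := by
    intro I i h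
    obtain ⟨k, _, h⟩ := mem_descents.1 h
    have := sizeUpTo_reverse_add I k
    refine mem_descents.2 ⟨I.length - k, Nat.sub_le _ _, ?_⟩
    rw [Fin.val_rev]
    omega
  refine ⟨key I i, fun h => ?_⟩
  rw [← I.reverse_reverse] at h
  simpa using key _ _ h

/-- A position and its mirror image in a block add up to the sum of the block's first and last
positions; the additive form avoids truncated subtraction. -/
theorem youngLongest_val (I : Composition n) (j : Fin n) :
    (youngLongest I j : ℕ) + j + 1 = I.sizeUpTo (I.index j) + I.sizeUpTo (I.index j + 1) := by
  have h1 := I.sizeUpTo_index_le j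
  have h2 := I.lt_sizeUpTo_index_succ j
  have h3 := I.sizeUpTo_succ' (I.index j)
  have : (youngLongest I j : ℕ) =
      I.sizeUpTo (I.index j) + (I.blocksFun (I.index j) - (j - I.sizeUpTo (I.index j) + 1)) := by
    simp [youngLongest, Equiv.permCongr_apply, Composition.blocksFinEquiv, Fin.val_rev]
  simp only [Fin.val_succ] at h2
  omega

theorem youngLongest_mul_self (I : Composition n) : youngLongest I * youngLongest I = 1 := by
  ext j
  simp [youngLongest, Equiv.permCongr_apply]

theorem youngLongest_inv (I : Composition n) : (youngLongest I)⁻¹ = youngLongest I :=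
  inv_eq_of_mul_eq_one_left (youngLongest_mul_self I)

theorem youngLongest_of_notMem {I : Composition n} {i : Fin (n - 1)} (h : i ∉ descents I) :
    (youngLongest I (lo i) : ℕ) = youngLongest I (hi i) + 1 := by
  have h1 := I.sizeUpTo_index_le (lo i)
  have h2 := I.lt_sizeUpTo_index_succ (lo i)
  have h3 : I.index (lo i) = I.index (hi i) := by
    rw [← Composition.mem_range_embedding_iff', Composition.mem_range_embedding_iff]
    refine ⟨h1.trans (lo_lt_hi i).le, ?_⟩
    have : I.sizeUpTo (I.index (lo i)).succ ≠ i + 1 := fun e =>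
      h (mem_descents.2 ⟨_, Nat.lt_succ_iff.1 (I.index (lo i)).succ.2, e⟩)
    simp only [lo, hi, Fin.val_succ, Nat.succ_eq_add_one] at *
    omega
  have h4 := youngLongest_val I (lo i)
  have h5 := youngLongest_val I (hi i)
  rw [← h3] at h5
  simp only [lo, hi] at *
  omega

theorem youngLongest_of_mem {I : Composition n} {i : Fin (n - 1)} (h : i ∈ descents I) :
    youngLongest I (lo i) < youngLongest I (hi i) := by
  obtain ⟨k, -, hk⟩ := mem_descents.1 h
  have h1 := I.sizeUpTo_index_le (lo i)
  have h2 := I.lt_sizeUpTo_index_succ (hi i)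
  have h4 := youngLongest_val I (lo i)
  have h5 := youngLongest_val I (hi i)
  have a : (I.index (lo i) : ℕ) + 1 ≤ k := by
    by_contra! hc
    have := I.monotone_sizeUpTo (Nat.lt_succ_iff.1 hc)
    have vl : (lo i : ℕ) = i := rfl
    omega
  have b : k ≤ I.index (hi i) := by
    by_contra! hc
    have := I.monotone_sizeUpTo (Nat.succ_le_of_lt hc)
    simp only [hi, Fin.val_succ, Nat.succ_eq_add_one] at *
    omega
  have a' := I.monotone_sizeUpTo a
  have b' := I.monotone_sizeUpTo b
  rw [Fin.lt_def]
  rw [Fin.val_succ] at h2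
  have vl : (lo i : ℕ) = i := rfl
  have vh : (hi i : ℕ) = i + 1 := rfl
  omega

theorem leftDescent_youngLongest_iff {I : Composition n} {i : Fin (n - 1)} :
    LeftDescent (youngLongest I) i ↔ i ∉ descents I := by
  rw [LeftDescent, youngLongest_inv]
  constructor
  · intro h h'
    exact lt_asymm h (youngLongest_of_mem h')
  · intro h
    have := youngLongest_of_notMem h
    rw [Fin.lt_def]
    omega

theorem rev_lo (i : Fin (n - 1)) : Fin.rev (lo i) = hi (Fin.rev i) := by
  simp only [lo, hi, Fin.ext_iff, Fin.val_rev]; omega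

theorem rev_hi (i : Fin (n - 1)) : Fin.rev (hi i) = lo (Fin.rev i) := by
  simp only [lo, hi, Fin.ext_iff, Fin.val_rev]; omega

theorem revPerm_inv : (Fin.revPerm : Equiv.Perm (Fin n))⁻¹ = Fin.revPerm := Fin.revPerm_symm

theorem leftDescent_revPerm_mul_iff {σ : Equiv.Perm (Fin n)} {i : Fin (n - 1)} :
    LeftDescent (Fin.revPerm * σ) i ↔ ¬ LeftDescent σ (Fin.rev i) := by
  simp only [LeftDescent, mul_inv_rev, Equiv.Perm.mul_apply, revPerm_inv, Fin.revPerm_apply,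
    rev_lo, rev_hi, not_lt]
  exact ⟨le_of_lt, fun h => lt_of_le_of_ne h fun e => lo_ne_hi _ (σ⁻¹.injective e)⟩

theorem leftDescent_revPerm_mul_youngLongest_iff {I : Composition n} {i : Fin (n - 1)} :
    LeftDescent (Fin.revPerm * youngLongest I.reverse) i ↔ i ∈ descents I := by
  rw [leftDescent_revPerm_mul_iff, leftDescent_youngLongest_iff, not_not, mem_descents_reverse,
    Fin.rev_rev]

/-- A simple reflection inside a block slides through the longest element of the Young subgroup. -/
theorem exists_sref_mul_eq {I : Composition n} {i : Fin (n - 1)} (h : i ∉ descents I) :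
    ∃ k, LeftDescent (youngLongest I.reverse) k ∧
      sref i * (Fin.revPerm * youngLongest I.reverse) =
        Fin.revPerm * youngLongest I.reverse * sref k := by
  set α := youngLongest I.reverse with hα
  have h' : Fin.rev i ∉ descents I.reverse := by rwa [mem_descents_reverse, Fin.rev_rev]
  have h1 := youngLongest_of_notMem h'
  rw [← hα] at h1
  have hb := (α (lo (Fin.rev i))).2
  -- `α` reverses a block containing both cells at `Fin.rev i`, so their images are adjacent, and
  -- the image of the upper cell is the lower one.
  set k : Fin (n - 1) := ⟨α (hi (Fin.rev i)), by omega⟩ with hk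
  have k1 : α (hi (Fin.rev i)) = lo k := Fin.ext rfl
  have k2 : α (lo (Fin.rev i)) = hi k := Fin.ext h1
  have inv : ∀ x, α (α x) = x := fun x => by
    rw [← Equiv.Perm.mul_apply, hα, youngLongest_mul_self, Equiv.Perm.one_apply]
  refine ⟨k, ?_, ?_⟩
  · rw [LeftDescent, hα, youngLongest_inv, ← hα, ← k1, ← k2, inv, inv]
    exact lo_lt_hi _
  · have e1 : (Fin.revPerm * α : Equiv.Perm (Fin n)) (lo k) = lo i := by
      rw [← k1, Equiv.Perm.mul_apply, inv, Fin.revPerm_apply, rev_hi, Fin.rev_rev]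
    have e2 : (Fin.revPerm * α : Equiv.Perm (Fin n)) (hi k) = hi i := by
      rw [← k2, Equiv.Perm.mul_apply, inv, Fin.revPerm_apply, rev_lo, Fin.rev_rev]
    rw [sref, sref, Equiv.mul_swap_eq_swap_mul, e1, e2]

/-! ### The defining relations in `H` -/

theorem eq_zero_of_smul_eq_smul {V : Type*} [AddCommGroup V] [Module ℂ V] {z w : ℂ} {x : V}
    (h : z • x = w • x) (hzw : z ≠ w) : x = 0 := by
  rw [← sub_eq_zero, ← sub_smul] at h
  exact (smul_eq_zero.1 h).resolve_left (sub_ne_zero.2 hzw)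

theorem T_mul_self (u : Fin r → ℂ) (i : Fin (n - 1)) : T u i * T u i = - T u i := by
  have h := RingQuot.mkAlgHom_rel ℂ (Rel.quadratic (r := r) (u := u) (q := 0) i)
  simp only [map_zero, sub_zero, map_mul, map_add, mul_add, mul_one] at h
  exact eq_neg_of_add_eq_zero_left h

theorem braided_T (u : Fin r → ℂ) : Braided (n := n) (T u) where
  braid i j h := by
    simpa only [map_mul] using! RingQuot.mkAlgHom_rel ℂ (Rel.braid (r := r) (u := u) (q := 0) i j h)
  comm i j h := by
    simpa only [map_mul] using! RingQuot.mkAlgHom_rel ℂ (Rel.T_comm (r := r) (u := u) (q := 0) i j h)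

/-- The quadratic relation absorbs the repeated `f i`, leaving `1 + f i + f j + f i * f j + f j * f
i + f i * f j * f i`, symmetric by the braid relation for `f`. -/
theorem Braided.one_add {A : Type*} [Ring A] {f : Fin (n - 1) → A} (hf : Braided f)
    (h : ∀ i, f i * f i = - f i) : Braided fun i => 1 + f i where
  braid i j hij := by
    have := hf.braid i j hij
    simp only [add_mul, mul_add, one_mul, mul_one, h, this]
    abel
  comm i j hij := by
    have := hf.comm i j hij
    simp only [add_mul, mul_add, one_mul, mul_one, this]
    abel

theorem ξ_mul_comm (u : Fin r → ℂ) (i j : Fin n) : ξ u i * ξ u j = ξ u j * ξ u i := by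
  simpa only [map_mul] using! RingQuot.mkAlgHom_rel ℂ (Rel.ξ_comm (r := r) (u := u) (q := 0) i j)

theorem mk_lagr (u : Fin r → ℂ) (k : Fin r) (j : Fin n) :
    RingQuot.mkAlgHom ℂ (Rel n r u 0) (lagr u k (fξ j)) = lagr u k (ξ u j) := by
  rw [lagr, lagr, ξ, aeval_algHom_apply]

theorem ξ_annihilate (u : Fin r → ℂ) (j : Fin n) :
    aeval (ξ u j) (∏ l, (X - C (u l))) = 0 := by
  have h := RingQuot.mkAlgHom_rel ℂ (Rel.annihilate (u := u) (q := 0) j)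
  rwa [map_zero, ← aeval_algHom_apply] at h

/-- The correction term of the exchange relation. -/
noncomputable def exchangeTerm (u : Fin r → ℂ) (i : Fin (n - 1)) : H n u :=
  ∑ a : Fin r, ∑ b : Fin r, if a < b then
    (u b - u a) • (lagr u a (ξ u (lo i)) * lagr u b (ξ u (hi i))) else 0

theorem T_mul_ξ_lo (u : Fin r → ℂ) (i : Fin (n - 1)) :
    T u i * ξ u (lo i) = ξ u (hi i) * T u i + exchangeTerm u i := by
  have h := RingQuot.mkAlgHom_rel ℂ (Rel.exchange (u := u) (q := 0) i)
  simp only [zero_sub, neg_smul, one_smul, sub_neg_eq_add, map_add, map_mul, map_sum, apply_ite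
    (RingQuot.mkAlgHom ℂ (Rel n r u 0)), map_smul, mk_lagr, map_zero] at h
  exact h

theorem T_mul_ξ_hi (u : Fin r → ℂ) (i : Fin (n - 1)) :
    T u i * ξ u (hi i) = ξ u (lo i) * T u i - exchangeTerm u i := by
  have h := RingQuot.mkAlgHom_rel ℂ (Rel.sum_comm (r := r) (u := u) (q := 0) i)
  simp only [map_add, map_mul] at h
  change T u i * (ξ u (hi i) + ξ u (lo i)) = (ξ u (hi i) + ξ u (lo i)) * T u i at h
  rw [mul_add, T_mul_ξ_lo, add_mul] at h
  rw [eq_sub_iff_add_eq, ← add_right_inj (ξ u (hi i) * T u i), ← h]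
  abel

theorem T_mul_ξ_of_ne (u : Fin r → ℂ) (i : Fin (n - 1)) (j : Fin n) (h₁ : j ≠ lo i)
    (h₂ : j ≠ hi i) : T u i * ξ u j = ξ u j * T u i := by
  simpa only [map_mul] using!
    RingQuot.mkAlgHom_rel ℂ (Rel.T_ξ_comm (r := r) (u := u) (q := 0) i j h₁ h₂)

/-- To prove a property of all elements of `H` it suffices to treat the generators. -/
theorem H_induction {u : Fin r → ℂ} {p : H n u → Prop} (hT : ∀ i, p (T u i)) (hξ : ∀ j, p (ξ u j))
    (hc : ∀ z : ℂ, p (algebraMap ℂ _ z)) (hadd : ∀ x y, p x → p y → p (x + y))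
    (hmul : ∀ x y, p x → p y → p (x * y)) (x : H n u) : p x := by
  obtain ⟨y, rfl⟩ := RingQuot.mkAlgHom_surjective ℂ (Rel n r u 0) x
  induction y using FreeAlgebra.induction with
  | grade0 z => simpa using hc z
  | grade1 s =>
    rcases s with i | j
    · exact hT i
    · exact hξ j
  | mul a b ha hb => simpa using hmul _ _ ha hb
  | add a b ha hb => simpa using hadd _ _ ha hb

/-! ### The idempotents `L_c` -/

theorem prod_dvd_X_sub_C_mul_basis (u : Fin r → ℂ) (a : Fin r) :
    ∏ l, (X - C (u l)) ∣ (X - C (u a)) * Lagrange.basis univ u a := by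
  rw [← mul_prod_erase univ _ (mem_univ a), Lagrange.basis]
  exact mul_dvd_mul_left _ (prod_dvd_prod_of_dvd _ _ fun l _ => by
    rw [Lagrange.basisDivisor]; exact dvd_mul_left _ _)

theorem ξ_mul_lagr (u : Fin r → ℂ) (a : Fin r) (j : Fin n) :
    ξ u j * lagr u a (ξ u j) = u a • lagr u a (ξ u j) := by
  have h : aeval (ξ u j) ((X - C (u a)) * Lagrange.basis univ u a) = 0 := by
    obtain ⟨p, hp⟩ := prod_dvd_X_sub_C_mul_basis u a
    rw [hp, map_mul, ξ_annihilate, zero_mul]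
  rw [map_mul, map_sub, aeval_X, aeval_C, sub_mul, sub_eq_zero, ← Algebra.smul_def] at h
  exact h

theorem sum_lagr {u : Fin r → ℂ} (hu : Function.Injective u) (j : Fin n) :
    ∑ a, lagr u a (ξ u j) = 1 := by
  -- With no colors the annihilating product is empty, so its relation says `1 = 0` in `H`.
  rcases r with _ | r
  · have h := ξ_annihilate u j
    simp only [univ_eq_empty, prod_empty, map_one] at h
    rw [univ_eq_empty, sum_empty, h]
  · simp only [lagr]
    rw [← map_sum, Lagrange.sum_basis hu.injOn univ_nonempty, map_one]

theorem ξ_commute_lagr (u : Fin r → ℂ) (a : Fin r) (i j : Fin n) :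
    Commute (ξ u i) (lagr u a (ξ u j)) := by
  rw [lagr, aeval_eq_sum_range]
  exact Commute.sum_right _ _ _ fun k _ => (Commute.pow_right (ξ_mul_comm u i j) k).smul_right _

/-- `x` slides past factors until it meets one on which it acts as the scalar; the factors need not
commute with each other. -/
theorem _root_.List.mul_prod_eq_smul_prod {A : Type*} [Ring A] [Algebra ℂ A] {x : A} {z : ℂ}
    {l : List A} (hc : ∀ a ∈ l, Commute x a) (h : ∃ a ∈ l, x * a = z • a) :
    x * l.prod = z • l.prod := by
  induction l with
  | nil => simp at h
  | cons b l ih =>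
    rw [List.prod_cons]
    by_cases hb : x * b = z • b
    · rw [← mul_assoc, hb, smul_mul_assoc]
    · have h' : ∃ a ∈ l, x * a = z • a := by
        obtain ⟨a, ha, hxa⟩ := h
        rcases List.mem_cons.1 ha with rfl | ha
        · exact absurd hxa hb
        · exact ⟨a, ha, hxa⟩
      rw [← mul_assoc, (hc b List.mem_cons_self).eq, mul_assoc,
        ih (fun a ha => hc a (List.mem_cons_of_mem _ ha)) h', mul_smul_comm]

theorem ξ_commute_L (u : Fin r → ℂ) (c : Fin n → Fin r) (j : Fin n) : Commute (ξ u j) (L u c) := by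
  rw [L]
  refine Commute.list_prod_right _ _ fun x hx => ?_
  obtain ⟨i, rfl⟩ := (List.mem_ofFn' _ _).1 hx
  exact ξ_commute_lagr u _ _ _

theorem ξ_mul_L (u : Fin r → ℂ) (c : Fin n → Fin r) (j : Fin n) :
    ξ u j * L u c = u (c j) • L u c := by
  rw [L]
  refine List.mul_prod_eq_smul_prod (fun x hx => ?_) ⟨lagr u (c j) (ξ u j), ?_, ξ_mul_lagr u _ _⟩
  · obtain ⟨i, rfl⟩ := (List.mem_ofFn' _ _).1 hx
    exact ξ_commute_lagr u _ _ _
  · exact (List.mem_ofFn' _ _).2 ⟨j, rfl⟩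

theorem L_mul_ξ (u : Fin r → ℂ) (c : Fin n → Fin r) (j : Fin n) :
    L u c * ξ u j = u (c j) • L u c := by
  rw [← (ξ_commute_L u c j).eq, ξ_mul_L]

theorem sum_prod_ofFn {A : Type*} [Ring A] {m : ℕ} (g : Fin m → Fin r → A) :
    ∑ c : Fin m → Fin r, (List.ofFn fun j => g j (c j)).prod =
      (List.ofFn fun j => ∑ a, g j a).prod := by
  induction m with
  | zero => simp
  | succ m ih =>
    rw [← (Fin.consEquiv fun _ => Fin r).sum_comp, Fintype.sum_prod_type]
    simp only [Fin.consEquiv_apply, List.ofFn_succ, Fin.cons_zero, Fin.cons_succ, List.prod_cons]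
    rw [← ih, sum_mul_sum]

theorem sum_L {u : Fin r → ℂ} (hu : Function.Injective u) :
    ∑ c : Fin n → Fin r, L u c = 1 := by
  simp only [L]
  rw [sum_prod_ofFn fun j a => lagr u a (ξ u j)]
  simp [sum_lagr hu]

theorem mul_aeval_eq_smul {A : Type*} [Ring A] [Algebra ℂ A] {x y : A} {z : ℂ} (h : x * y = z • x)
    (p : ℂ[X]) : x * aeval y p = p.eval z • x := by
  induction p using Polynomial.induction_on' with
  | add p q hp hq => rw [map_add, mul_add, hp, hq, eval_add, add_smul]
  | monomial k a =>
    have : x * y ^ k = z ^ k • x := by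
      induction k with
      | zero => simp
      | succ k ih => rw [pow_succ, ← mul_assoc, ih, smul_mul_assoc, h, smul_smul, pow_succ]
    rw [aeval_monomial, eval_monomial, ← Algebra.smul_def, mul_smul_comm, this, smul_smul]

theorem L_mul_lagr {u : Fin r → ℂ} (hu : Function.Injective u) (c : Fin n → Fin r) (a : Fin r)
    (j : Fin n) : L u c * lagr u a (ξ u j) = if a = c j then L u c else 0 := by
  rw [lagr, mul_aeval_eq_smul (L_mul_ξ u c j)]
  split_ifs with h
  · rw [h, Lagrange.eval_basis_self hu.injOn (mem_univ _), one_smul]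
  · rw [Lagrange.eval_basis_of_ne h (mem_univ _), zero_smul]

/-- `L u c` evaluates the Lagrange polynomials at its own eigenvalues, which selects the single
summand `a = c (lo i)`, `b = c (hi i)`. -/
theorem L_mul_exchangeTerm {u : Fin r → ℂ} (hu : Function.Injective u) (c : Fin n → Fin r)
    (i : Fin (n - 1)) : L u c * exchangeTerm u i =
      if c (lo i) < c (hi i) then (u (c (hi i)) - u (c (lo i))) • L u c else 0 := by
  have : ∀ a b : Fin r, L u c * (if a < b then
      (u b - u a) • (lagr u a (ξ u (lo i)) * lagr u b (ξ u (hi i))) else 0) =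
      if a = c (lo i) then (if b = c (hi i) then (if a < b then (u b - u a) • L u c else 0) else 0)
        else 0 := by
    intro a b
    rw [mul_ite, mul_smul_comm, ← mul_assoc, L_mul_lagr hu, mul_zero, ite_mul, zero_mul,
      L_mul_lagr hu]
    split_ifs <;> simp
  simp only [exchangeTerm, mul_sum, this]
  simp

/-- Orthogonality comes from distinct eigenvalues of some `ξ u j`; idempotence follows on
multiplying `∑ L = 1` by `L u c`. -/
theorem L_mul_L {u : Fin r → ℂ} (hu : Function.Injective u) (c d : Fin n → Fin r) :
    L u c * L u d = if c = d then L u c else 0 := by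
  have ne : ∀ c d : Fin n → Fin r, c ≠ d → L u c * L u d = 0 := by
    intro c d h
    obtain ⟨j, hj⟩ := Function.ne_iff.1 h
    have : u (c j) • (L u c * L u d) = u (d j) • (L u c * L u d) := by
      rw [← smul_mul_assoc, ← L_mul_ξ, mul_assoc, ξ_mul_L, mul_smul_comm]
    exact eq_zero_of_smul_eq_smul this (hu.ne hj)
  split_ifs with h
  · subst h
    conv_rhs => rw [← mul_one (L u c), ← sum_L hu, mul_sum,
      sum_eq_single c (fun d _ hd => ne c d hd.symm) (by simp)]
  · exact ne c d h

/-! ### Commutation of `T_i` with `L_c` -/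

/-- Up to the exchange term, which dies between `L u d` and `L u c`, `T_i` intertwines `ξ_{s_i j}`
with `ξ_j`. The block is thus multiplied equally by `u (d j)` and `u (c (s_i j))`, which differ for
some `j`. -/
theorem L_mul_T_mul_L_eq_zero {u : Fin r → ℂ} (hu : Function.Injective u) {c d : Fin n → Fin r}
    {i : Fin (n - 1)} (h₁ : d ≠ c) (h₂ : d ≠ c ∘ sref i) : L u d * T u i * L u c = 0 := by
  have hX : L u d * exchangeTerm u i * L u c = 0 := by
    rw [L_mul_exchangeTerm hu]
    split_ifs
    · rw [smul_mul_assoc, L_mul_L hu, if_neg h₁, smul_zero]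
    · rw [zero_mul]
  obtain ⟨j, hj⟩ := Function.ne_iff.1 h₂
  rw [Function.comp_apply] at hj
  by_cases j1 : j = lo i
  · subst j1
    rw [sref_lo] at hj
    refine eq_zero_of_smul_eq_smul (z := u (d (lo i))) (w := u (c (hi i))) ?_ (hu.ne hj)
    rw [eq_comm, mul_assoc, ← mul_smul_comm, ← mul_smul_comm, ← ξ_mul_L, ← mul_assoc (T u i), T_mul_ξ_hi,
      sub_mul, mul_sub, ← mul_assoc _ (exchangeTerm u i), hX, sub_zero, ← mul_assoc, ← mul_assoc,
      L_mul_ξ, smul_mul_assoc, smul_mul_assoc, mul_assoc]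
  by_cases j2 : j = hi i
  · subst j2
    rw [sref_hi] at hj
    refine eq_zero_of_smul_eq_smul (z := u (d (hi i))) (w := u (c (lo i))) ?_ (hu.ne hj)
    rw [eq_comm, mul_assoc, ← mul_smul_comm, ← mul_smul_comm, ← ξ_mul_L, ← mul_assoc (T u i), T_mul_ξ_lo,
      add_mul, mul_add, ← mul_assoc _ (exchangeTerm u i), hX, add_zero, ← mul_assoc, ← mul_assoc,
      L_mul_ξ, smul_mul_assoc, smul_mul_assoc, mul_assoc]
  · rw [sref_of_ne i j1 j2] at hj
    refine eq_zero_of_smul_eq_smul (z := u (d j)) (w := u (c j)) ?_ (hu.ne hj)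
    rw [eq_comm, mul_assoc, ← mul_smul_comm, ← mul_smul_comm, ← ξ_mul_L, ← mul_assoc (T u i),
      T_mul_ξ_of_ne u i j j1 j2, ← mul_assoc, ← mul_assoc,
      L_mul_ξ, smul_mul_assoc, smul_mul_assoc, mul_assoc]

/-- On the diagonal the exchange term survives, and its factor `u (c (hi i)) - u (c (lo i))` is
minus the difference of eigenvalues to be divided out. -/
theorem L_mul_T_mul_L_self {u : Fin r → ℂ} (hu : Function.Injective u) {c : Fin n → Fin r}
    {i : Fin (n - 1)} (h : c (lo i) ≠ c (hi i)) :
    L u c * T u i * L u c = if c (lo i) < c (hi i) then - L u c else 0 := by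
  have e : u (c (lo i)) • (L u c * T u i * L u c) =
      u (c (hi i)) • (L u c * T u i * L u c) +
        if c (lo i) < c (hi i) then (u (c (hi i)) - u (c (lo i))) • L u c else 0 := by
    have hX : L u c * exchangeTerm u i * L u c =
        if c (lo i) < c (hi i) then (u (c (hi i)) - u (c (lo i))) • L u c else 0 := by
      rw [L_mul_exchangeTerm hu, ite_mul, zero_mul, smul_mul_assoc, L_mul_L hu, if_pos rfl]
    rw [← hX, ← mul_smul_comm, ← ξ_mul_L, ← mul_assoc, mul_assoc _ (T u i), T_mul_ξ_lo,
      mul_add, add_mul, ← mul_assoc _ _ (T u i), L_mul_ξ, smul_mul_assoc, smul_mul_assoc]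
  have hne : u (c (lo i)) ≠ u (c (hi i)) := hu.ne h
  have cancel : ∀ {V : Type} [AddCommGroup V] [Module ℂ V] {z w : ℂ} {x y : V},
      z • x = w • x + (w - z) • y → z ≠ w → x = - y := by
    intro V _ _ z w x y h hzw
    refine eq_neg_of_add_eq_zero_left (eq_zero_of_smul_eq_smul (z := z) (w := w) ?_ hzw)
    rw [smul_add, h, sub_smul, smul_add]
    abel
  split_ifs at e ⊢
  · exact cancel e hne
  · rw [add_zero] at e
    exact eq_zero_of_smul_eq_smul e hne

theorem comp_sref_eq_self {α : Type*} {c : Fin n → α} {i : Fin (n - 1)} (h : c (lo i) = c (hi i)) :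
    c ∘ sref i = c := by
  funext j
  rw [Function.comp_apply]
  by_cases j1 : j = lo i
  · rw [j1, sref_lo, h]
  by_cases j2 : j = hi i
  · rw [j2, sref_hi, h]
  · rw [sref_of_ne i j1 j2]

theorem comp_sref_ne_self {α : Type*} {c : Fin n → α} {i : Fin (n - 1)} (h : c (lo i) ≠ c (hi i)) :
    c ∘ sref i ≠ c := by
  intro e
  have := congrFun e (lo i)
  rw [Function.comp_apply, sref_lo] at this
  exact h this.symm

theorem comp_sref_sref {α : Type*} (c : Fin n → α) (i : Fin (n - 1)) :
    (c ∘ sref i) ∘ sref i = c := by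
  funext j
  simp

theorem T_mul_L_of_eq {u : Fin r → ℂ} (hu : Function.Injective u) {c : Fin n → Fin r}
    {i : Fin (n - 1)} (h : c (lo i) = c (hi i)) : T u i * L u c = L u c * T u i := by
  have hs := comp_sref_eq_self h
  calc T u i * L u c = (∑ d, L u d) * T u i * L u c := by rw [sum_L hu, one_mul]
    _ = L u c * T u i * L u c := by
      rw [sum_mul, sum_mul, sum_eq_single c _ (by simp)]
      intro d _ hd
      exact L_mul_T_mul_L_eq_zero hu hd (by rwa [hs])
    _ = L u c * T u i * ∑ d, L u d := by
      rw [mul_sum, sum_eq_single c _ (by simp)]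
      intro d _ hd
      refine L_mul_T_mul_L_eq_zero hu hd.symm fun e => hd ?_
      rw [← comp_sref_sref d i, ← e, hs]
    _ = L u c * T u i := by rw [sum_L hu, mul_one]

/-- Only two blocks of `T_i L_c` survive. The off-diagonal one, `L_d T_i L_c` with `d = c ∘ s_i`,
equals `L_d T_i - L_d T_i L_d`, so known diagonal blocks account for the correction. -/
theorem T_mul_L_of_ne {u : Fin r → ℂ} (hu : Function.Injective u) {c : Fin n → Fin r}
    {i : Fin (n - 1)} (h : c (lo i) ≠ c (hi i)) : T u i * L u c = L u (c ∘ sref i) * T u i +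
      if c (lo i) < c (hi i) then - L u c else L u (c ∘ sref i) := by
  have hs := comp_sref_ne_self h
  set d := c ∘ sref i with hd
  have hdc : d ∘ sref i = c := comp_sref_sref c i
  have e1 : T u i * L u c = L u d * T u i * L u c + L u c * T u i * L u c := by
    calc T u i * L u c = (∑ d, L u d) * T u i * L u c := by rw [sum_L hu, one_mul]
      _ = _ := by
        rw [sum_mul, sum_mul, ← sum_subset (subset_univ {d, c}), sum_pair hs]
        intro e _ he
        simp only [mem_insert, mem_singleton, not_or] at he
        exact L_mul_T_mul_L_eq_zero hu he.2 he.1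
  have e2 : L u d * T u i = L u d * T u i * L u c + L u d * T u i * L u d := by
    calc L u d * T u i = L u d * T u i * ∑ e, L u e := by rw [sum_L hu, mul_one]
      _ = _ := by
        rw [mul_sum, ← sum_subset (subset_univ {c, d}), sum_pair hs.symm]
        intro e _ he
        simp only [mem_insert, mem_singleton, not_or] at he
        refine L_mul_T_mul_L_eq_zero hu (Ne.symm he.2) fun e' => he.1 ?_
        rw [← hdc, e', comp_sref_sref]
  have dl : d (lo i) = c (hi i) := by simp [hd]
  have dh : d (hi i) = c (lo i) := by simp [hd]
  have s1 := L_mul_T_mul_L_self hu h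
  have s2 := L_mul_T_mul_L_self hu (c := d) (i := i) (by rw [dl, dh]; exact h.symm)
  rw [dl, dh] at s2
  rw [eq_comm, e2, eq_comm, e1, s1, s2]
  rcases lt_or_gt_of_ne h with hlt | hlt
  · rw [if_pos hlt, if_pos hlt, if_neg (lt_asymm hlt), add_zero]
  · rw [if_neg (lt_asymm hlt), if_neg (lt_asymm hlt), if_pos hlt]
    abel

/-! ### The action of `T_i` on the standard generators -/

theorem T_mul_Tperm_of_leftDescent (u : Fin r → ℂ) {σ : Equiv.Perm (Fin n)} {i : Fin (n - 1)}
    (h : LeftDescent σ i) : T u i * Tperm u σ = - Tperm u σ := by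
  change T u i * wordProd (T u) σ = - wordProd (T u) σ
  rw [(braided_T u).mul_wordProd_of_leftDescent h, ← mul_assoc, T_mul_self]
  exact neg_mul (α := H n u) _ _

theorem T_mul_Tperm (u : Fin r → ℂ) {σ : Equiv.Perm (Fin n)} {i : Fin (n - 1)}
    (h : ¬ LeftDescent σ i) : T u i * Tperm u σ = Tperm u (sref i * σ) :=
  ((braided_T u).wordProd_sref_mul h).symm

theorem T_mul_Sqperm_of_leftDescent (u : Fin r → ℂ) {σ : Equiv.Perm (Fin n)} {i : Fin (n - 1)}
    (h : LeftDescent σ i) : T u i * Sqperm u σ = 0 := by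
  change T u i * wordProd (fun i => 1 + T u i) σ = 0
  rw [((braided_T u).one_add (T_mul_self u)).mul_wordProd_of_leftDescent h, ← mul_assoc, mul_add,
    mul_one, T_mul_self, add_neg_cancel, zero_mul]

theorem T_mul_etaHecke_of_mem (u : Fin r → ℂ) {I : Composition n} {i : Fin (n - 1)}
    (h : i ∈ descents I) : T u i * etaHecke u I = - etaHecke u I := by
  rw [etaHecke, ← mul_assoc, T_mul_Tperm_of_leftDescent u
    (leftDescent_revPerm_mul_youngLongest_iff.2 h)]
  exact neg_mul (α := H n u) _ _

/-- `T_i` passes through the first factor and comes out as `T_k` with `k` a left descent of the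
second permutation, where `T_k (1 + T_k) = 0`. -/
theorem T_mul_etaHecke_of_notMem (u : Fin r → ℂ) {I : Composition n} {i : Fin (n - 1)}
    (h : i ∉ descents I) : T u i * etaHecke u I = 0 := by
  have hd := mt leftDescent_revPerm_mul_youngLongest_iff.1 h
  obtain ⟨k, hk, e⟩ := exists_sref_mul_eq h
  have hT : T u i * Tperm u (Fin.revPerm * youngLongest I.reverse) =
      Tperm u (Fin.revPerm * youngLongest I.reverse) * T u k := by
    rw [T_mul_Tperm u hd, e]
    exact (braided_T u).wordProd_mul_sref (by rw [← e, len_sref_mul hd])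
  rw [etaHecke, ← mul_assoc, hT, mul_assoc, T_mul_Sqperm_of_leftDescent u hk, mul_zero]

/-! ### Simultaneous eigenvectors in arbitrary modules -/

section Module

variable {u : Fin r → ℂ} {M : Type*} [AddCommGroup M] [Module (H n u) M]

theorem T_smul_L_smul_of_eq (hu : Function.Injective u) {c : Fin n → Fin r} {i : Fin (n - 1)}
    (h : c (lo i) = c (hi i)) (m : M) : T u i • L u c • m = L u c • T u i • m := by
  rw [smul_smul, T_mul_L_of_eq hu h, mul_smul]

theorem T_smul_L_smul_of_lt (hu : Function.Injective u) {c : Fin n → Fin r} {i : Fin (n - 1)}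
    (h : c (lo i) < c (hi i)) (m : M) :
    T u i • L u c • m = L u (c ∘ sref i) • T u i • m - L u c • m := by
  rw [smul_smul, T_mul_L_of_ne hu h.ne, if_pos h, add_smul, mul_smul, neg_smul, sub_eq_add_neg]

theorem T_smul_L_smul_of_gt (hu : Function.Injective u) {c : Fin n → Fin r} {i : Fin (n - 1)}
    (h : c (hi i) < c (lo i)) (m : M) :
    T u i • L u c • m = L u (c ∘ sref i) • T u i • m + L u (c ∘ sref i) • m := by
  rw [smul_smul, T_mul_L_of_ne hu h.ne', if_neg (lt_asymm h), add_smul, mul_smul]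

/-- `v` is a simultaneous eigenvector: `ξ_j` acts by `u_{c_j}`, and `T_i` acts by `-1` if `i ∈ D` and
by `0` otherwise. -/
structure IsEigen (u : Fin r → ℂ) {M : Type*} [AddCommGroup M] [Module (H n u) M] (v : M) (c : Fin n → Fin r) (D : Finset (Fin (n - 1))) : Prop where
  ξ_smul : ∀ j, ξ u j • v = algebraMap ℂ (H n u) (u (c j)) • v
  T_smul : ∀ i, T u i • v = if i ∈ D then -v else 0

theorem ξ_smul_L_smul (c : Fin n → Fin r) (m : M) (j : Fin n) :
    ξ u j • L u c • m = algebraMap ℂ (H n u) (u (c j)) • L u c • m := by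
  rw [smul_smul, ξ_mul_L, Algebra.smul_def, mul_smul]

theorem mem_descents_phi {R : ColoredRibbon n r} {i : Fin (n - 1)} :
    i ∈ descents R.phi.shape ↔ if R.color (lo i) = R.color (hi i) then i ∈ descents R.shape
      else i ∉ descents R.shape := by
  rw [descents, ColoredRibbon.phi, Equiv.apply_symm_apply, mem_filter]
  simp

/-- For unequal colors the cycloribbon condition leaves two cases. If `T_i m = 0` the colors
increase and only `-L_c m` remains; if `T_i m = -m` they decrease and the two `L_{cs} m` cancel. -/
theorem isEigen_L_smul (hu : Function.Injective u) {R : ColoredRibbon n r} (hR : R.IsCycloribbon)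
    {m : M} (hm : ∀ i, T u i • m = if i ∈ descents R.shape then -m else 0) :
    IsEigen u (L u R.color • m) R.color (descents R.phi.shape) where
  ξ_smul j := ξ_smul_L_smul R.color m j
  T_smul i := by
    have h := hm i
    simp only [mem_descents_phi]
    by_cases hi : i ∈ descents R.shape
    · rw [if_pos hi] at h
      rcases ((hR i).2 hi).lt_or_eq with hlt | heq
      · rw [T_smul_L_smul_of_gt hu hlt, h]
        simp [hlt.ne', hi]
      · rw [T_smul_L_smul_of_eq hu heq.symm, h]
        simp [heq, hi]
    · rw [if_neg hi] at h
      rcases ((hR i).1 hi).lt_or_eq with hlt | heq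
      · rw [T_smul_L_smul_of_lt hu hlt, h]
        simp [hlt.ne, hi]
      · rw [T_smul_L_smul_of_eq hu heq, h]
        simp [heq, hi]

theorem isEigen_eta (hu : Function.Injective u) {R : ColoredRibbon n r} (hR : R.IsCycloribbon) :
    IsEigen u (eta u R) R.color (descents R.phi.shape) := by
  refine isEigen_L_smul hu hR (m := etaHecke u R.shape) fun i => ?_
  split_ifs with h
  · exact T_mul_etaHecke_of_mem u h
  · exact T_mul_etaHecke_of_notMem u h

theorem eq_zero_of_algebraMap_smul_eq {z w : ℂ} {v : M}
    (h : algebraMap ℂ (H n u) z • v = algebraMap ℂ (H n u) w • v) (hzw : z ≠ w) : v = 0 := by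
  let _ := Module.compHom M (algebraMap ℂ (H n u))
  exact eq_zero_of_smul_eq_smul (V := M) h hzw

/-- Treating two vectors at once makes the scalar common to both, which is what identifies their
annihilators later. -/
theorem IsEigen.exists_smul {N : Type*} [AddCommGroup N] [Module (H n u) N] {v : M} {w : N}
    {c : Fin n → Fin r} {D : Finset (Fin (n - 1))} (hv : IsEigen u v c D) (hw : IsEigen u w c D)
    (x : H n u) :
    ∃ z : ℂ, x • v = algebraMap ℂ (H n u) z • v ∧ x • w = algebraMap ℂ (H n u) z • w := by
  induction x using H_induction with
  | hT i =>
    refine ⟨if i ∈ D then -1 else 0, ?_⟩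
    rw [hv.T_smul, hw.T_smul]
    split_ifs <;> simp
  | hξ j => exact ⟨_, hv.ξ_smul j, hw.ξ_smul j⟩
  | hc z => exact ⟨z, rfl, rfl⟩
  | hadd x y hx hy =>
    obtain ⟨a, h1, h2⟩ := hx
    obtain ⟨b, h3, h4⟩ := hy
    exact ⟨a + b, by rw [add_smul, h1, h3, map_add, add_smul],
      by rw [add_smul, h2, h4, map_add, add_smul]⟩
  | hmul x y hx hy =>
    obtain ⟨a, h1, h2⟩ := hx
    obtain ⟨b, h3, h4⟩ := hy
    refine ⟨b * a, ?_, ?_⟩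
    · rw [mul_smul, h3, smul_smul, ← (Algebra.commutes b x), mul_smul, h1, map_mul, mul_smul]
    · rw [mul_smul, h4, smul_smul, ← (Algebra.commutes b x), mul_smul, h2, map_mul, mul_smul]

theorem IsEigen.L_smul (hu : Function.Injective u) {v : M} {c : Fin n → Fin r}
    {D : Finset (Fin (n - 1))} (hv : IsEigen u v c D) : L u c • v = v := by
  have h0 : ∀ d, d ≠ c → L u d • v = 0 := by
    intro d hd
    obtain ⟨j, hj⟩ := Function.ne_iff.1 hd
    refine eq_zero_of_algebraMap_smul_eq (n := n) (u := u) (z := u (d j)) (w := u (c j)) ?_ (hu.ne hj)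
    rw [smul_smul, ← Algebra.smul_def, ← L_mul_ξ, mul_smul, hv.ξ_smul, smul_smul, smul_smul,
      Algebra.commutes]
  calc L u c • v = ∑ d, L u d • v := (sum_eq_single c (fun d _ hd => h0 d hd) (by simp)).symm
    _ = v := by rw [← sum_smul, sum_L hu, one_smul]

/-- Since `L u c` fixes `v`, the diagonal block of `T_i`, already known for unequal colors, is the
eigenvalue of `T_i` on `v`. -/
theorem IsEigen.mem_iff_lt (hu : Function.Injective u) {v : M} (hv0 : v ≠ 0) {c : Fin n → Fin r}
    {D : Finset (Fin (n - 1))} (hv : IsEigen u v c D) {i : Fin (n - 1)} (h : c (lo i) ≠ c (hi i)) :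
    i ∈ D ↔ c (lo i) < c (hi i) := by
  have e : (L u c * T u i * L u c) • v = if i ∈ D then -v else 0 := by
    rw [mul_smul, mul_smul, hv.L_smul hu, hv.T_smul]
    split_ifs
    · rw [smul_neg, hv.L_smul hu]
    · rw [smul_zero]
  rw [L_mul_T_mul_L_self hu h] at e
  by_cases h1 : c (lo i) < c (hi i) <;> by_cases h2 : i ∈ D
  · simp [h1, h2]
  · simp [h1, h2, hv.L_smul hu, hv0] at e
  · simp [h1, h2, hv0] at e
  · simp [h1, h2]

theorem IsEigen.unique (hu : Function.Injective u) {v : M} (hv0 : v ≠ 0) {c c' : Fin n → Fin r}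
    {D D' : Finset (Fin (n - 1))} (hv : IsEigen u v c D) (hv' : IsEigen u v c' D') :
    c = c' ∧ D = D' := by
  constructor
  · funext j
    by_contra hj
    refine hv0 (eq_zero_of_algebraMap_smul_eq (n := n) (u := u) ?_ (hu.ne hj))
    rw [← hv.ξ_smul, hv'.ξ_smul]
  · ext i
    have h := (hv.T_smul i).symm.trans (hv'.T_smul i)
    by_cases h1 : i ∈ D <;> by_cases h2 : i ∈ D' <;> simp_all

/-- An eigenvector belongs to a unique cycloribbon. -/
theorem IsEigen.exists_cycloribbon (hu : Function.Injective u) {v : M} (hv0 : v ≠ 0)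
    {c : Fin n → Fin r} {D : Finset (Fin (n - 1))} (hv : IsEigen u v c D) :
    ∃ R : ColoredRibbon n r, R.IsCycloribbon ∧ IsEigen u v R.color (descents R.phi.shape) := by
  -- Switching membership at unequal colors is an involution, so the shape is obtained by applying
  -- `φ` to `D`.
  set E : Finset (Fin (n - 1)) := univ.filter fun i =>
    if c (lo i) = c (hi i) then i ∈ D else i ∉ D with hE
  set R : ColoredRibbon n r := ⟨(descentEquiv n).symm E, c⟩ with hR
  have hs : descents R.shape = E := (descentEquiv n).apply_symm_apply E
  have hmem : ∀ i, i ∈ E ↔ if c (lo i) = c (hi i) then i ∈ D else i ∉ D := by simp [hE]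
  refine ⟨R, fun i => ?_, ?_⟩
  · rw [hs, hmem]
    change (_ → c (lo i) ≤ c (hi i)) ∧ (_ → c (hi i) ≤ c (lo i))
    by_cases h : c (lo i) = c (hi i)
    · simp [h]
    · rw [if_neg h, hv.mem_iff_lt hu hv0 h, not_not, not_lt]
      exact ⟨le_of_lt, id⟩
  · have : descents R.phi.shape = D := by
      ext i
      rw [mem_descents_phi, hs, hmem]
      change (if c (lo i) = c (hi i) then _ else _) ↔ _
      by_cases h : c (lo i) = c (hi i) <;> simp [h]
    rw [this]
    exact hv

/-- A vector whose `H`-orbit is a line, and another one with the same eigenvalues. -/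
theorem IsEigen.exists_linearEquiv {N : Type*} [AddCommGroup N] [Module (H n u) N] {v : M} {w : N}
    {c : Fin n → Fin r} {D : Finset (Fin (n - 1))} (hv : IsEigen u v c D) (hw : IsEigen u w c D)
    (hv0 : v ≠ 0) (hw0 : w ≠ 0) (hM : ∀ x : M, ∃ h : H n u, h • v = x)
    (hN : ∀ x : N, ∃ h : H n u, h • w = x) : Nonempty (M ≃ₗ[H n u] N) := by
  -- Both modules are cyclic, so equal annihilators of the generators make them the same quotient of
  -- `H`.
  have hker : LinearMap.ker (LinearMap.toSpanSingleton (H n u) M v) =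
      LinearMap.ker (LinearMap.toSpanSingleton (H n u) N w) := by
    ext x
    simp only [LinearMap.mem_ker, LinearMap.toSpanSingleton_apply]
    obtain ⟨z, h1, h2⟩ := hv.exists_smul hw x
    rw [h1, h2]
    by_cases hz : z = 0
    · simp [hz]
    · constructor <;> intro h
      · exact absurd (eq_zero_of_algebraMap_smul_eq (n := n) (u := u) (w := 0) (by simpa using h) hz) hv0
      · exact absurd (eq_zero_of_algebraMap_smul_eq (n := n) (u := u) (w := 0) (by simpa using h) hz) hw0
  exact ⟨((LinearMap.quotKerEquivOfSurjective _ fun x => hM x).symm.trans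
    (Submodule.quotEquivOfEq _ _ hker)).trans
    (LinearMap.quotKerEquivOfSurjective _ fun x => hN x)⟩

/-! ### Existence of eigenvectors -/

/-- Take `σ` of maximal length with `T_σ` nonzero on `M`: left descents of `σ` act by `-1` on its
image, and any other `T_i` gives a longer element, which annihilates `M`. -/
theorem exists_T_eigenvector (u : Fin r → ℂ) (M : Type*) [AddCommGroup M] [Module (H n u) M]
    [Nontrivial M] :
    ∃ m : M, m ≠ 0 ∧ ∃ D : Finset (Fin (n - 1)), ∀ i, T u i • m = if i ∈ D then -m else 0 := by
  classical
  set s : Finset (Equiv.Perm (Fin n)) := univ.filter fun σ => ∃ m : M, Tperm u σ • m ≠ 0 with hs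
  have hne : s.Nonempty := by
    obtain ⟨m, hm⟩ := exists_ne (0 : M)
    refine ⟨1, ?_⟩
    have : Tperm u (1 : Equiv.Perm (Fin n)) = 1 := by
      change wordProd (T u) 1 = 1
      rw [(braided_T u).wordProd_eq (w := []) (by simp) (by simp)]
      simp
    simp only [hs, mem_filter, mem_univ, true_and, this, one_smul]
    exact ⟨m, hm⟩
  obtain ⟨σ, hσ, hmax⟩ := exists_max_image s len hne
  obtain ⟨m, hm⟩ := (mem_filter.1 hσ).2
  refine ⟨Tperm u σ • m, hm, univ.filter fun i => LeftDescent σ i, fun i => ?_⟩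
  rw [smul_smul]
  by_cases h : LeftDescent σ i
  · simp [h, T_mul_Tperm_of_leftDescent u h]
  · rw [T_mul_Tperm u h]
    by_contra hc
    have : sref i * σ ∈ s := by
      refine mem_filter.2 ⟨mem_univ _, m, ?_⟩
      simpa [h] using hc
    have := hmax _ this
    rw [len_sref_mul h] at this
    omega

/-- These weights make `∑ p_j c_j` increase under exactly those color swaps whose `L_{cs} m` terms
obstruct an eigenvector: increasing colors at `D`, decreasing ones elsewhere. -/
theorem exists_potential (D : Finset (Fin (n - 1))) : ∃ p : Fin n → ℤ,
    ∀ i, p (lo i) - p (hi i) = if i ∈ D then 1 else -1 := by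
  refine ⟨fun j => ∑ k : Fin (n - 1), if (k : ℕ) < j then (if k ∈ D then -1 else 1) else 0,
    fun i => ?_⟩
  simp only
  rw [← sum_sub_distrib, sum_eq_single i]
  · by_cases h : i ∈ D <;> simp [lo, hi, h]
  · intro k _ hk
    have h1 : (k : ℕ) < hi i ↔ (k : ℕ) < lo i := by
      have := Fin.val_ne_of_ne hk
      simp only [lo, hi]
      omega
    simp only [h1, sub_self]
  · simp

theorem sum_mul_comp_sref (p x : Fin n → ℤ) (i : Fin (n - 1)) :
    ∑ j, p j * x (sref i j) =
      ∑ j, p j * x j + (p (lo i) - p (hi i)) * (x (hi i) - x (lo i)) := by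
  rw [← sub_eq_iff_eq_add', ← sum_sub_distrib, ← sum_subset (subset_univ {lo i, hi i}),
    sum_pair (lo_ne_hi i), sref_lo, sref_hi]
  · ring
  · intro j _ hj
    simp only [mem_insert, mem_singleton, not_or] at hj
    rw [sref_of_ne i hj.1 hj.2, sub_self]

/-- Starting from a `T`-eigenvector `m`, choose `c` maximizing the weighted sum among colorings with
`L_c m ≠ 0`. By maximality every obstructing `L_{cs} m` is zero. -/
theorem exists_isEigen (hu : Function.Injective u) [Nontrivial M] :
    ∃ v : M, v ≠ 0 ∧ ∃ (c : Fin n → Fin r) (D : Finset (Fin (n - 1))), IsEigen (n := n) u v c D := by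
  classical
  obtain ⟨m, hm0, D, hm⟩ := exists_T_eigenvector (n := n) u M
  obtain ⟨p, hp⟩ := exists_potential D
  set s : Finset (Fin n → Fin r) := univ.filter fun c => L u c • m ≠ 0 with hs
  have hne : s.Nonempty := by
    by_contra hc
    rw [not_nonempty_iff_eq_empty, filter_eq_empty_iff] at hc
    apply hm0
    rw [← one_smul (H n u) m, ← sum_L hu, sum_smul]
    exact sum_eq_zero fun c hcu => not_not.1 (hc hcu)
  obtain ⟨c, hc, hmax⟩ := exists_max_image s (fun c => ∑ j, p j * ((c j : ℕ) : ℤ)) hne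
  have hzero : ∀ i, 0 < (p (lo i) - p (hi i)) * (((c (hi i) : ℕ) : ℤ) - ((c (lo i) : ℕ) : ℤ)) →
      L u (c ∘ sref i) • m = 0 := by
    intro i hi
    by_contra h
    have := hmax (c ∘ sref i) (mem_filter.2 ⟨mem_univ _, h⟩)
    simp only [Function.comp_apply] at this
    rw [sum_mul_comp_sref p (fun j => ((c j : ℕ) : ℤ))] at this
    linarith
  refine ⟨L u c • m, (mem_filter.1 hc).2, c, univ.filter fun i => T u i • L u c • m ≠ 0,
    ξ_smul_L_smul c m, fun i => ?_⟩
  have key : T u i • L u c • m = - (L u c • m) ∨ T u i • L u c • m = 0 := by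
    rcases lt_trichotomy (c (lo i)) (c (hi i)) with h | h | h
    · left
      rw [T_smul_L_smul_of_lt hu h, hm]
      split_ifs with hD
      · have := hzero i (by rw [hp, if_pos hD, one_mul, sub_pos]; exact_mod_cast h)
        rw [smul_neg, this, neg_zero, zero_sub]
      · rw [smul_zero, zero_sub]
    · rw [T_smul_L_smul_of_eq hu h, hm]
      split_ifs
      · left; rw [smul_neg]
      · right; rw [smul_zero]
    · right
      rw [T_smul_L_smul_of_gt hu h, hm]
      split_ifs with hD
      · rw [smul_neg, neg_add_cancel]
      · have := hzero i (by
          rw [hp, if_neg hD, neg_one_mul, neg_sub, sub_pos]; exact_mod_cast h)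
        rw [smul_zero, this, zero_add]

  by_cases h0 : T u i • L u c • m = 0
  · simp [h0]
  · simpa [h0] using key.resolve_right h0

end Module

/-! ### Induced representations -/

section Rep

variable {V : Type*} [AddCommGroup V] [Module ℂ V] {κ : Type*} [LinearOrder κ]

/-- The action of `T_i` on the functions from colorings to a module `V` over the `0`-Hecke algebra
on which `T_i` acts by `t i`. -/
def inducedT (κ : Type*) [LinearOrder κ] (t : Fin (n - 1) → Module.End ℂ V) (i : Fin (n - 1)) :
    Module.End ℂ ((Fin n → κ) → V) where
  toFun f c := t i (f (c ∘ sref i)) + if c (lo i) < c (hi i) then f (c ∘ sref i) - f c else 0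
  map_add' f g := by
    funext c
    simp only [Pi.add_apply, map_add]
    split_ifs <;> abel
  map_smul' z f := by
    funext c
    simp only [Pi.smul_apply, map_smul, RingHom.id_apply, smul_add, smul_ite, smul_zero, smul_sub]

theorem inducedT_apply (t : Fin (n - 1) → Module.End ℂ V) (i : Fin (n - 1))
    (f : (Fin n → κ) → V) (c : Fin n → κ) : inducedT κ t i f c =
      t i (f (c ∘ sref i)) + if c (lo i) < c (hi i) then f (c ∘ sref i) - f c else 0 := rfl

theorem inducedT_mul_self {t : Fin (n - 1) → Module.End ℂ V} (h : ∀ i, t i * t i = - t i)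
    (i : Fin (n - 1)) : inducedT κ t i * inducedT κ t i = - inducedT κ t i := by
  have h' : ∀ x, t i (t i x) = - t i x := fun x => LinearMap.congr_fun (h i) x
  ext f c
  simp only [Module.End.mul_apply, LinearMap.neg_apply, Pi.neg_apply, inducedT_apply,
    comp_sref_sref, Function.comp_apply, sref_lo, sref_hi]
  rcases lt_trichotomy (c (lo i)) (c (hi i)) with hc | hc | hc
  · simp only [hc, lt_asymm hc, if_true, if_false, h', add_zero]
    abel
  · simp [hc, h', comp_sref_eq_self hc]
  · simp only [hc, lt_asymm hc, if_true, if_false, map_add, map_sub, h', add_zero]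
    abel

theorem braided_inducedT {t : Fin (n - 1) → Module.End ℂ V} (h : ∀ i, t i * t i = - t i)
    (ht : Braided t) : Braided (inducedT κ t) where
  braid i j hij := by
    have hi' : ∀ x, t i (t i x) = - t i x := fun x => LinearMap.congr_fun (h i) x
    have hj' : ∀ x, t j (t j x) = - t j x := fun x => LinearMap.congr_fun (h j) x
    have hb : ∀ x, t i (t j (t i x)) = t j (t i (t j x)) :=
      fun x => LinearMap.congr_fun (ht.braid i j hij) x
    have hadj := hi_eq_lo hij
    have n1 : hi j ≠ lo i := by simp only [lo, hi, ne_eq, Fin.ext_iff]; omega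
    have n2 : hi j ≠ hi i := by simp only [hi, ne_eq, Fin.ext_iff]; omega
    have n3 : lo i ≠ lo j := by simp only [lo, ne_eq, Fin.ext_iff]; omega
    have s1 : sref i (hi j) = hi j := sref_of_ne i n1 n2
    have s2 : sref j (lo i) = lo i := sref_of_ne j n3 n1.symm
    have s3 : sref i (lo j) = lo i := by rw [← hadj, sref_hi]
    have s4 : sref i (lo i) = lo j := by rw [← hadj, sref_lo]
    have hs : ∀ c : Fin n → κ, ((c ∘ sref i) ∘ sref j) ∘ sref i =
        ((c ∘ sref j) ∘ sref i) ∘ sref j := by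
      intro c
      funext a
      have := Equiv.congr_fun (sref_braid hij) a
      simp only [Equiv.Perm.mul_apply] at this
      simp only [Function.comp_apply, this]
    ext f c
    simp only [Module.End.mul_apply, inducedT_apply, comp_sref_sref, Function.comp_apply, sref_lo,
      sref_hi, hadj, s1, s2, s3, s4, hs]
    -- Only the relative order of three colors matters. These identities merge the argument words
    -- that coincide when two of the colors are equal.
    have q1 : c (lo i) = c (lo j) → c ∘ sref i = c := fun e =>
      comp_sref_eq_self (by rw [hadj, e])
    have q2 : c (lo j) = c (hi j) → c ∘ sref j = c := fun e => comp_sref_eq_self e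
    have q3 : c (lo i) = c (hi j) → (c ∘ sref i) ∘ sref j = c ∘ sref i := fun e =>
      comp_sref_eq_self (by simp [s1, s3, e])
    have q4 : c (lo i) = c (hi j) → (c ∘ sref j) ∘ sref i = c ∘ sref j := fun e =>
      comp_sref_eq_self (by simp [hadj, s2, e])
    have q5 : c (lo i) = c (lo j) →
        ((c ∘ sref j) ∘ sref i) ∘ sref j = (c ∘ sref j) ∘ sref i := fun e =>
      comp_sref_eq_self (by simp [s1, s2, s3, e])
    rcases lt_trichotomy (c (lo i)) (c (lo j)) with h1 | h1 | h1 <;>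
    rcases lt_trichotomy (c (lo j)) (c (hi j)) with h2 | h2 | h2 <;>
    rcases lt_trichotomy (c (lo i)) (c (hi j)) with h3 | h3 | h3
    all_goals first
      | (exfalso; order)
      | (simp only [q1, q2, q3, q4, q5, comp_sref_sref, h1, h2, h3, h1.not_gt, h2.not_gt, h3.not_gt,
           lt_irrefl, if_true, if_false, map_add, map_sub, hi', hj', hb, add_zero]
         try abel)
  comm i j hij := by
    have hc : ∀ x, t i (t j x) = t j (t i x) := fun x => LinearMap.congr_fun (ht.comm i j hij) x
    have s1 : sref i (hi j) = hi j := by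
      apply sref_of_ne <;> simp only [lo, hi, ne_eq, Fin.ext_iff] <;> omega
    have s2 : sref i (lo j) = lo j := by
      apply sref_of_ne <;> simp only [lo, hi, ne_eq, Fin.ext_iff] <;> omega
    have s3 : sref j (hi i) = hi i := by
      apply sref_of_ne <;> simp only [lo, hi, ne_eq, Fin.ext_iff] <;> omega
    have s4 : sref j (lo i) = lo i := by
      apply sref_of_ne <;> simp only [lo, hi, ne_eq, Fin.ext_iff] <;> omega
    have hs : ∀ c : Fin n → κ, (c ∘ sref i) ∘ sref j = (c ∘ sref j) ∘ sref i := by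
      intro c
      funext a
      have := Equiv.congr_fun (sref_comm hij) a
      simp only [Equiv.Perm.mul_apply] at this
      simp only [Function.comp_apply, this]
    ext f c
    simp only [Module.End.mul_apply, inducedT_apply, Function.comp_apply, s1, s2, s3, s4, hs,
      map_add, hc]
    split_ifs <;> simp only [map_sub, map_zero] <;> abel

theorem braided_zero {A : Type*} [Ring A] : Braided (fun _ : Fin (n - 1) => (0 : A)) :=
  ⟨by simp, by simp⟩

/-- The action of `ξ_j` on functions on colorings. -/
noncomputable def inducedξ (u : Fin r → ℂ) (j : Fin n) : Module.End ℂ ((Fin n → Fin r) → V) where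
  toFun f c := u (c j) • f c
  map_add' f g := by
    funext c
    simp
  map_smul' z f := by
    funext c
    simp [smul_smul, mul_comm]

theorem inducedξ_apply (u : Fin r → ℂ) (j : Fin n) (f : (Fin n → Fin r) → V) (c : Fin n → Fin r) :
    inducedξ u j f c = u (c j) • f c := rfl

theorem aeval_inducedξ_apply (u : Fin r → ℂ) (j : Fin n) (p : ℂ[X]) (f : (Fin n → Fin r) → V)
    (c : Fin n → Fin r) : aeval (inducedξ (V := V) u j) p f c = p.eval (u (c j)) • f c := by
  induction p using Polynomial.induction_on' with
  | add p q hp hq => rw [map_add, LinearMap.add_apply, Pi.add_apply, hp, hq, eval_add, add_smul]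
  | monomial k a =>
    have : ((inducedξ (V := V) u j) ^ k) f c = u (c j) ^ k • f c := by
      induction k with
      | zero => simp
      | succ k ih => rw [pow_succ', Module.End.mul_apply, inducedξ_apply, ih, smul_smul, pow_succ']
    rw [aeval_monomial, eval_monomial, Module.End.mul_apply, Module.algebraMap_end_apply,
      Pi.smul_apply, this, smul_smul]

theorem lagr_inducedξ_apply {u : Fin r → ℂ} (hu : Function.Injective u) (a : Fin r) (j : Fin n)
    (f : (Fin n → Fin r) → V) (c : Fin n → Fin r) :
    lagr u a (inducedξ (V := V) u j) f c = if a = c j then f c else 0 := by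
  rw [lagr, aeval_inducedξ_apply]
  split_ifs with h
  · rw [h, Lagrange.eval_basis_self hu.injOn (mem_univ _), one_smul]
  · rw [Lagrange.eval_basis_of_ne h (mem_univ _), zero_smul]

theorem map_lagr {A B : Type*} [Ring A] [Algebra ℂ A] [Ring B] [Algebra ℂ B] (φ : A →ₐ[ℂ] B)
    (u : Fin r → ℂ) (a : Fin r) (x : A) : φ (lagr u a x) = lagr u a (φ x) := by
  rw [lagr, lagr, aeval_algHom_apply]

/-- The representation of `H` induced from a module over the `0`-Hecke algebra. -/
noncomputable def inducedHom {u : Fin r → ℂ} (hu : Function.Injective u)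
    {t : Fin (n - 1) → Module.End ℂ V} (h : ∀ i, t i * t i = - t i) (ht : Braided t) :
    H n u →ₐ[ℂ] Module.End ℂ ((Fin n → Fin r) → V) :=
  RingQuot.liftAlgHom ℂ ⟨FreeAlgebra.lift ℂ (Sum.elim (inducedT (Fin r) t) (inducedξ u)), by
    have eT : ∀ i, FreeAlgebra.lift ℂ (Sum.elim (inducedT (Fin r) t) (inducedξ u)) (fT i) =
        inducedT (Fin r) t i := fun i => by simp [fT]
    have eξ : ∀ j, FreeAlgebra.lift ℂ (Sum.elim (inducedT (Fin r) t) (inducedξ u)) (fξ j) =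
        inducedξ u j := fun i => by simp [fξ]
    have hb := braided_inducedT (κ := Fin r) h ht
    intro x y hxy
    induction hxy with
    | quadratic i =>
      simp only [map_mul, map_add, map_zero, eT, sub_zero, mul_add, mul_one,
        inducedT_mul_self h, neg_add_cancel]
    | braid i j hij => simpa only [map_mul, eT] using hb.braid i j hij
    | T_comm i j hij => simpa only [map_mul, eT] using hb.comm i j hij
    | annihilate j =>
      rw [← aeval_algHom_apply, eξ, map_zero]
      refine LinearMap.ext fun f => funext fun c => ?_
      rw [aeval_inducedξ_apply, eval_prod, prod_eq_zero (mem_univ (c j)) (by simp), zero_smul]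
      rfl
    | ξ_comm i j =>
      rw [map_mul, map_mul, eξ, eξ]
      refine LinearMap.ext fun f => funext fun c => ?_
      simp only [Module.End.mul_apply, inducedξ_apply]
      rw [smul_comm]
    | exchange i =>
      simp only [map_sub, map_mul, map_smul, map_sum, apply_ite (FreeAlgebra.lift ℂ
        (Sum.elim (inducedT (Fin r) t) (inducedξ u))), map_zero, map_lagr, eT, eξ]
      refine LinearMap.ext fun f => funext fun c => ?_
      have hsum : (∑ a : Fin r, ∑ b : Fin r, if a < b then (u b - u a) •
          (lagr u a (inducedξ (V := V) u (lo i)) * lagr u b (inducedξ u (hi i))) else 0 :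
            Module.End ℂ ((Fin n → Fin r) → V)) f c =
          if c (lo i) < c (hi i) then (u (c (hi i)) - u (c (lo i))) • f c else 0 := by
        have : ∀ a b : Fin r, ((if a < b then (u b - u a) •
            (lagr u a (inducedξ (V := V) u (lo i)) * lagr u b (inducedξ u (hi i))) else 0) :
              Module.End ℂ ((Fin n → Fin r) → V)) f c =
            if a = c (lo i) then (if b = c (hi i) then
              (if a < b then (u b - u a) • f c else 0) else 0) else 0 := by
          intro a b
          split_ifs with h1 h2 h3 <;> simp [lagr_inducedξ_apply hu, *]
        simp only [LinearMap.sum_apply, Finset.sum_apply, this]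
        simp
      rw [LinearMap.sub_apply, Pi.sub_apply, LinearMap.smul_apply, Pi.smul_apply, hsum, zero_sub,
        neg_one_smul, sub_neg_eq_add]
      simp only [Module.End.mul_apply, inducedξ_apply, inducedT_apply, Function.comp_apply, sref_lo,
        map_smul, smul_add, smul_ite, smul_zero, smul_sub, sub_smul]
      split_ifs <;> abel
    | sum_comm i =>
      rw [map_mul, map_mul, map_add, eT, eξ, eξ]
      refine LinearMap.ext fun f => funext fun c => ?_
      simp only [Module.End.mul_apply, LinearMap.add_apply, Pi.add_apply, inducedξ_apply,
        inducedT_apply, Function.comp_apply, sref_lo, sref_hi, map_add, map_smul, smul_add,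
        smul_ite, smul_zero, smul_sub]
      split_ifs <;> abel
    | T_ξ_comm i j h₁ h₂ =>
      rw [map_mul, map_mul, eT, eξ]
      refine LinearMap.ext fun f => funext fun c => ?_
      simp only [Module.End.mul_apply, inducedξ_apply, inducedT_apply, Function.comp_apply,
        sref_of_ne i h₁ h₂, map_smul, smul_add, smul_ite, smul_zero, smul_sub]⟩

variable {u : Fin r → ℂ} (hu : Function.Injective u) {t : Fin (n - 1) → Module.End ℂ V}
  (h : ∀ i, t i * t i = - t i) (ht : Braided t)

theorem inducedHom_T (i : Fin (n - 1)) : inducedHom hu h ht (T u i) = inducedT (Fin r) t i := by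
  simp [inducedHom, T, fT]

theorem inducedHom_ξ (j : Fin n) : inducedHom hu h ht (ξ u j) = inducedξ u j := by
  simp [inducedHom, ξ, fξ]

theorem inducedHom_L_apply (c : Fin n → Fin r) (f : (Fin n → Fin r) → V) :
    inducedHom hu h ht (L u c) f c = f c := by
  have key : ∀ l : List (Module.End ℂ ((Fin n → Fin r) → V)), (∀ x ∈ l, ∀ g, x g c = g c) →
      l.prod f c = f c := by
    intro l
    induction l with
    | nil => simp
    | cons x l ih =>
      intro hl
      rw [List.prod_cons, Module.End.mul_apply, hl x List.mem_cons_self,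
        ih fun y hy => hl y (List.mem_cons_of_mem _ hy)]
  rw [L, map_list_prod, List.map_ofFn]
  apply key
  intro x hx g
  obtain ⟨j, rfl⟩ := (List.mem_ofFn' _ _).1 hx
  simp only [Function.comp_apply]
  rw [map_lagr, inducedHom_ξ, lagr_inducedξ_apply hu, if_pos rfl]

theorem prod_map_const {ι W : Type*} [AddCommGroup W] [Module ℂ W] {F : ι → Module.End ℂ W}
    {G : ι → Module.End ℂ V} {k : V → W} (hk : ∀ i m, F i (k m) = k (G i m)) (w : List ι) (m : V) :
    (w.map F).prod (k m) = k ((w.map G).prod m) := by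
  induction w with
  | nil => simp
  | cons i w ih => simp [ih, hk]

/-- On constant functions the difference in `inducedT` vanishes, so `T_i` acts through `t i` and the
colors play no role. -/
theorem inducedHom_etaHecke_const (I : Composition n) (m : V) :
    inducedHom hu h ht (etaHecke u I) (fun _ => m) = fun _ =>
      wordProd t (Fin.revPerm * youngLongest I.reverse)
        (wordProd (fun i => 1 + t i) (youngLongest I.reverse) m) := by
  have hT : ∀ i (m : V), inducedHom hu h ht (T u i) (fun _ => m) = fun _ => t i m := by
    intro i m
    rw [inducedHom_T]
    funext c
    simp [inducedT_apply]
  have hS : ∀ i (m : V), inducedHom hu h ht (1 + T u i) (fun _ => m) = fun _ => (1 + t i) m := by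
    intro i m
    rw [map_add, map_one, LinearMap.add_apply, hT]
    rfl
  rw [etaHecke, map_mul, Module.End.mul_apply, Tperm, Sqperm, map_list_prod, map_list_prod,
    List.map_map, List.map_map, Function.comp_def, Function.comp_def]
  rw [prod_map_const (k := fun (m : V) (_ : Fin n → Fin r) => m) hS,
    prod_map_const (k := fun (m : V) (_ : Fin n → Fin r) => m) hT]
  rfl

end Rep

/-! ### Nonvanishing of the generators -/

/-- The sorting operators on functions on words, shifted by a scalar. -/
noncomputable def sortOp (p : Fin (n - 1) × ℂ) : Module.End ℂ ((Fin n → Fin n) → ℂ) :=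
  inducedT (Fin n) (fun _ => (0 : Module.End ℂ ℂ)) p.1 + p.2 • 1

theorem sortOp_apply (p : Fin (n - 1) × ℂ) (g : (Fin n → Fin n) → ℂ) (x : Fin n → Fin n) :
    sortOp p g x = (if x (lo p.1) < x (hi p.1) then g (x ∘ sref p.1) - g x else 0) + p.2 * g x := by
  simp [sortOp, inducedT_apply]

theorem len_le_of_inv_mul_eq_revPerm (l : List (Fin (n - 1) × ℂ)) (y : Equiv.Perm (Fin n))
    (h : y⁻¹ * (l.map fun p => sref p.1).prod = Fin.revPerm) :
    len (Fin.revPerm : Equiv.Perm (Fin n)) ≤ len y + l.length := by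
  induction l generalizing y with
  | nil =>
    have : y = Fin.revPerm := by
      rw [← revPerm_inv, ← h]; simp
    simp [this]
  | cons p l ih =>
    have h1 := ih (sref p.1 * y) (by rw [← h]; simp [mul_assoc])
    have h2 := len_sref_mul_le y p.1
    rw [List.length_cons]
    omega

theorem comp_sref_eq (y : Equiv.Perm (Fin n)) (i : Fin (n - 1)) :
    (⇑y⁻¹ : Fin n → Fin n) ∘ sref i = ⇑(sref i * y)⁻¹ := by
  rw [mul_inv_rev, sref_inv, Equiv.Perm.coe_mul]

theorem not_leftDescent_iff {y : Equiv.Perm (Fin n)} {i : Fin (n - 1)} :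
    ¬ LeftDescent y i ↔ y⁻¹ (lo i) < y⁻¹ (hi i) := by
  rw [LeftDescent, not_lt]
  exact ⟨fun h => lt_of_le_of_ne h fun e => lo_ne_hi _ (y⁻¹.injective e), le_of_lt⟩

/-- Each operator mixes the value at `y⁻¹` only with that at `(s_i y)⁻¹`, so too few letters cannot
reach the support of the delta function. -/
theorem prod_sortOp_eq_zero (l : List (Fin (n - 1) × ℂ)) (y : Equiv.Perm (Fin n))
    (h : len y + l.length < len (Fin.revPerm : Equiv.Perm (Fin n))) :
    (l.map sortOp).prod (Pi.single (⇑(Fin.revPerm : Equiv.Perm (Fin n))) 1) (⇑y⁻¹) = 0 := by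
  induction l generalizing y with
  | nil =>
    rw [List.map_nil, List.prod_nil, Module.End.one_apply, Pi.single_eq_of_ne]
    intro e
    have : y = Fin.revPerm := by
      rw [← inv_inj, revPerm_inv]
      exact DFunLike.coe_injective e
    simp [this] at h
  | cons p l ih =>
    rw [List.length_cons] at h
    have h2 := len_sref_mul_le y p.1
    rw [List.map_cons, List.prod_cons, Module.End.mul_apply, sortOp_apply, comp_sref_eq,
      ih y (by omega), ih (sref p.1 * y) (by omega)]
    simp

/-- With just enough letters each one must raise the length. Staying put is fatal by
`prod_sortOp_eq_zero`, so the scalar shifts are irrelevant and a single path of coefficient `1`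
remains. -/
theorem prod_sortOp_eq_one (l : List (Fin (n - 1) × ℂ)) (y : Equiv.Perm (Fin n))
    (h : len y + l.length = len (Fin.revPerm : Equiv.Perm (Fin n)))
    (hy : y⁻¹ * (l.map fun p => sref p.1).prod = Fin.revPerm) :
    (l.map sortOp).prod (Pi.single (⇑(Fin.revPerm : Equiv.Perm (Fin n))) 1) (⇑y⁻¹) = 1 := by
  induction l generalizing y with
  | nil =>
    rw [List.map_nil, List.prod_nil, mul_one] at hy
    rw [List.map_nil, List.prod_nil, Module.End.one_apply, hy, Pi.single_eq_same]
  | cons p l ih =>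
    rw [List.length_cons] at h
    have hy' : (sref p.1 * y)⁻¹ * (l.map fun p => sref p.1).prod = Fin.revPerm := by
      rw [← hy]; simp [mul_assoc]
    have h1 := len_le_of_inv_mul_eq_revPerm l _ hy'
    have h2 := len_sref_mul_le y p.1
    have h3 : ¬ LeftDescent y p.1 := not_leftDescent_of_len (by omega)
    rw [List.map_cons, List.prod_cons, Module.End.mul_apply, sortOp_apply, comp_sref_eq,
      if_pos (not_leftDescent_iff.1 h3), prod_sortOp_eq_zero l y (by omega),
      ih (sref p.1 * y) (by omega) hy']
    simp

/-- Test on the constant function with value a delta at the reversed word, inside the sorting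
representation. The words for `w₀α` and `α` concatenate to a reduced word of `w₀`, so the value at
color `R.color` and the identity word is `1`. -/
theorem eta_ne_zero {u : Fin r → ℂ} (hu : Function.Injective u) (R : ColoredRibbon n r) :
    eta u R ≠ 0 := by
  intro h0
  set t := inducedT (n := n) (Fin n) (fun _ => (0 : Module.End ℂ ℂ)) with ht
  have h1 : ∀ i, t i * t i = - t i := inducedT_mul_self (by simp)
  have h2 : Braided t := braided_inducedT (by simp) braided_zero
  set δ : (Fin n → Fin n) → ℂ := Pi.single (⇑(Fin.revPerm : Equiv.Perm (Fin n))) 1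
  set α := youngLongest R.shape.reverse with hα
  -- Shift `0` encodes a factor `T_i`, shift `1` a factor `1 + T_i`.
  set l : List (Fin (n - 1) × ℂ) := (reducedWord (Fin.revPerm * α)).map (fun i => (i, 0)) ++
    (reducedWord α).map (fun i => (i, 1)) with hl
  have e1 : inducedHom hu h1 h2 (eta u R) (fun _ => δ) R.color (⇑(1 : Equiv.Perm (Fin n))⁻¹) =
      (l.map sortOp).prod δ (⇑(1 : Equiv.Perm (Fin n))⁻¹) := by
    rw [eta, map_mul, Module.End.mul_apply, inducedHom_L_apply, inducedHom_etaHecke_const, hl,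
      List.map_append, List.prod_append, Module.End.mul_apply, List.map_map, List.map_map]
    have s0 : ∀ i : Fin (n - 1), sortOp (i, 0) = t i := fun i => by simp [sortOp, ht]
    have s1 : ∀ i : Fin (n - 1), sortOp (i, 1) = 1 + t i := fun i => by
      simp [sortOp, ht, add_comm]
    simp only [Function.comp_def, s0, s1]
    rfl
  rw [h0, map_zero, prod_sortOp_eq_one l 1] at e1
  · exact zero_ne_one e1
  · rw [len_one, zero_add, hl, List.length_append, List.length_map, List.length_map,
      reducedWord_length, reducedWord_length, len_revPerm_mul]
  · rw [hl, List.map_append, List.prod_append, List.map_map, List.map_map, inv_one, one_mul]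
    change ((reducedWord _).map sref).prod * ((reducedWord _).map sref).prod = _
    rw [reducedWord_prod, reducedWord_prod, mul_assoc, hα, youngLongest_mul_self, mul_one]

/-! ### Modules generated by an eigenvector -/

section Module

variable {u : Fin r → ℂ} {M : Type*} [AddCommGroup M] [Module (H n u) M]

theorem IsEigen.smul {v : M} {c : Fin n → Fin r} {D : Finset (Fin (n - 1))} (hv : IsEigen u v c D)
    (x : H n u) : IsEigen u (x • v) c D := by
  obtain ⟨z, hz, -⟩ := hv.exists_smul hv x
  constructor
  · intro j
    rw [hz, smul_smul, ← Algebra.commutes, mul_smul, hv.ξ_smul, smul_smul, smul_smul,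
      Algebra.commutes]
  · intro i
    rw [hz, smul_smul, ← Algebra.commutes, mul_smul, hv.T_smul]
    split_ifs
    · rw [smul_neg]
    · rw [smul_zero]

theorem IsEigen.map {N : Type*} [AddCommGroup N] [Module (H n u) N] {v : M} {c : Fin n → Fin r}
    {D : Finset (Fin (n - 1))} (hv : IsEigen u v c D) (f : M →ₗ[H n u] N) :
    IsEigen u (f v) c D where
  ξ_smul j := by rw [← map_smul, hv.ξ_smul, map_smul]
  T_smul i := by rw [← map_smul, hv.T_smul, apply_ite f, map_neg, map_zero]

theorem IsEigen.isSimpleModule {v : M} {c : Fin n → Fin r} {D : Finset (Fin (n - 1))}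
    (hv : IsEigen u v c D) (hv0 : v ≠ 0) (hM : ∀ x : M, ∃ h : H n u, h • v = x) :
    IsSimpleModule (H n u) M := by
  rw [isSimpleModule_iff_toSpanSingleton_surjective]
  refine ⟨⟨v, 0, hv0⟩, fun x hx y => ?_⟩
  obtain ⟨h, rfl⟩ := hM x
  obtain ⟨k, rfl⟩ := hM y
  obtain ⟨z, hz, -⟩ := hv.exists_smul hv h
  have hz0 : z ≠ 0 := by
    rintro rfl
    rw [hz, map_zero, zero_smul] at hx
    exact hx rfl
  refine ⟨k * algebraMap ℂ (H n u) z⁻¹, ?_⟩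
  rw [LinearMap.toSpanSingleton_apply, hz, smul_smul, mul_assoc, ← map_mul, inv_mul_cancel₀ hz0,
    map_one, mul_one]

theorem exists_smul_eq_of_isSimpleModule [IsSimpleModule (H n u) M] {v : M} (hv0 : v ≠ 0) (x : M) :
    ∃ h : H n u, h • v = x :=
  (isSimpleModule_iff_toSpanSingleton_surjective.1 ‹_›).2 v hv0 x

theorem IsEigen.finrank_eq_one [Module ℂ M] [IsScalarTower ℂ (H n u) M] {v : M} {c : Fin n → Fin r}
    {D : Finset (Fin (n - 1))} (hv : IsEigen u v c D) (hv0 : v ≠ 0)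
    (hM : ∀ x : M, ∃ h : H n u, h • v = x) : Module.finrank ℂ M = 1 := by
  refine _root_.finrank_eq_one v hv0 fun x => ?_
  obtain ⟨h, rfl⟩ := hM x
  obtain ⟨z, hz, -⟩ := hv.exists_smul hv h
  exact ⟨z, by rw [hz, algebraMap_smul]⟩

/-- The generator of `S_{[I, c]}`, as an element of it. -/
noncomputable def gen (u : Fin r → ℂ) (R : ColoredRibbon n r) : S u R :=
  ⟨eta u R, Submodule.mem_span_singleton_self _⟩

theorem gen_ne_zero (hu : Function.Injective u) (R : ColoredRibbon n r) : gen u R ≠ 0 :=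
  fun h => eta_ne_zero hu R (congrArg Subtype.val h)

theorem exists_smul_gen (R : ColoredRibbon n r) (x : S u R) : ∃ h : H n u, h • gen u R = x := by
  obtain ⟨h, hh⟩ := Submodule.mem_span_singleton.1 x.2
  exact ⟨h, Subtype.ext hh⟩

theorem isEigen_gen (hu : Function.Injective u) {R : ColoredRibbon n r} (hR : R.IsCycloribbon) :
    IsEigen u (gen u R) R.color (descents R.phi.shape) where
  ξ_smul j := Subtype.ext ((isEigen_eta hu hR).ξ_smul j)
  T_smul i := by
    apply Subtype.ext
    have := (isEigen_eta hu hR).T_smul i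
    split_ifs at this ⊢ <;> exact this

theorem isSimpleModule_S (hu : Function.Injective u) {R : ColoredRibbon n r}
    (hR : R.IsCycloribbon) : IsSimpleModule (H n u) (S u R) :=
  (isEigen_gen hu hR).isSimpleModule (gen_ne_zero hu R) (exists_smul_gen R)

theorem eq_of_color_eq_of_descents_eq {R R' : ColoredRibbon n r} (hc : R.color = R'.color)
    (hD : descents R.phi.shape = descents R'.phi.shape) : R = R' := by
  refine ColoredRibbon.ext ((descentEquiv n).injective (Finset.ext fun i => ?_)) hc
  have h : i ∈ descents R.phi.shape ↔ i ∈ descents R'.phi.shape := by rw [hD]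
  rw [mem_descents_phi, mem_descents_phi, hc] at h
  split_ifs at h
  · exact h
  · exact not_iff_not.1 h

theorem eq_of_S_equiv (hu : Function.Injective u) {R R' : ColoredRibbon n r} (hR : R.IsCycloribbon)
    (hR' : R'.IsCycloribbon) (e : S u R ≃ₗ[H n u] S u R') : R = R' := by
  have h1 := (isEigen_gen hu hR).map (N := S u R') e.toLinearMap
  obtain ⟨h, hh⟩ := exists_smul_gen R' (e (gen u R))
  have h2 := (isEigen_gen hu hR').smul h
  rw [hh] at h2
  obtain ⟨hc, hD⟩ := h1.unique hu (by simpa using gen_ne_zero hu R) h2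
  exact eq_of_color_eq_of_descents_eq hc hD

theorem exists_equiv_S (hu : Function.Injective u) [IsSimpleModule (H n u) M] :
    ∃ R : ColoredRibbon n r, R.IsCycloribbon ∧ Nonempty (M ≃ₗ[H n u] S u R) := by
  have : Nontrivial M := IsSimpleModule.nontrivial (H n u) M
  obtain ⟨v, hv0, c, D, hv⟩ := exists_isEigen (n := n) (M := M) hu
  obtain ⟨R, hR, hv⟩ := hv.exists_cycloribbon hu hv0
  exact ⟨R, hR, hv.exists_linearEquiv (isEigen_gen hu hR) hv0 (gen_ne_zero hu R)
    (exists_smul_eq_of_isSimpleModule hv0) (exists_smul_gen R)⟩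

end Module

/-! ### Counting cycloribbons -/

/-- Summing over the first color with the others fixed gives `r + 1`: weight `2` for a repeat of the
next color, `1` for each of the other `r - 1`. -/
theorem sum_prod_ite_eq (r m : ℕ) :
    ∑ c : Fin (m + 1) → Fin r, ∏ i : Fin m, (if c i.castSucc = c i.succ then 2 else 1) =
      r * (r + 1) ^ m := by
  induction m with
  | zero => simp
  | succ m ih =>
    have h : ∀ x : Fin r, ∑ a : Fin r, (if a = x then 2 else 1) = r + 1 := by
      intro x
      have : ∀ a : Fin r, (if a = x then 2 else 1) = 1 + if a = x then 1 else 0 := fun a => by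
        split_ifs <;> rfl
      simp [this, sum_add_distrib]
    rw [← (Fin.consEquiv fun _ => Fin r).sum_comp, Fintype.sum_prod_type, sum_comm]
    simp only [Fin.consEquiv_apply, Fin.prod_univ_succ, Fin.castSucc_zero, Fin.cons_zero,
      Fin.cons_succ, ← Fin.succ_castSucc, ← sum_mul, h]
    rw [← mul_sum, ih, pow_succ]
    ring

/-- The choices for `i` (`true` for a descent) allowed in a cycloribbon of color `c`. -/
def allowed (c : Fin n → Fin r) (i : Fin (n - 1)) : Finset Bool :=
  univ.filter fun b => if b = true then c (hi i) ≤ c (lo i) else c (lo i) ≤ c (hi i)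

theorem card_allowed (c : Fin n → Fin r) (i : Fin (n - 1)) :
    (allowed c i).card = if c (lo i) = c (hi i) then 2 else 1 := by
  rw [allowed, Fintype.univ_bool]
  rcases lt_trichotomy (c (lo i)) (c (hi i)) with h | h | h
  · simp [filter_insert, filter_singleton, h.le, h.not_ge, h.ne]
  · simp [filter_insert, filter_singleton, h]
  · simp [filter_insert, filter_singleton, h.le, h.not_ge, h.ne']

/-- A colored ribbon is a coloring together with a choice for each position. -/
def ribbonEquiv (n r : ℕ) : ColoredRibbon n r ≃ (Fin n → Fin r) × (Fin (n - 1) → Bool) where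
  toFun R := (R.color, fun i => decide (i ∈ descents R.shape))
  invFun p := ⟨(descentEquiv n).symm (univ.filter fun i => p.2 i = true), p.1⟩
  left_inv R := by
    refine ColoredRibbon.ext ?_ rfl
    rw [Equiv.symm_apply_eq]
    ext i
    rw [mem_filter, decide_eq_true_iff]
    exact ⟨And.right, fun h => ⟨mem_univ _, h⟩⟩
  right_inv p := by
    refine Prod.ext rfl (funext fun i => ?_)
    change decide (i ∈ (descentEquiv n) ((descentEquiv n).symm _)) = _
    rw [Equiv.apply_symm_apply]
    simp

theorem isCycloribbon_iff (R : ColoredRibbon n r) : R.IsCycloribbon ↔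
    ∀ i, (ribbonEquiv n r R).2 i ∈ allowed (ribbonEquiv n r R).1 i := by
  refine forall_congr' fun i => ?_
  rw [allowed, mem_filter]
  by_cases h : i ∈ descents R.shape <;> simp [ribbonEquiv, h]

/-- For a fixed coloring the positions are independent: two choices where neighbors agree, one
otherwise. For `n = 0` there is one ribbon, while the truncated formula would give `r`. -/
theorem card_cycloribbon (hn : 1 ≤ n) :
    Nat.card {R : ColoredRibbon n r // R.IsCycloribbon} = r * (r + 1) ^ (n - 1) := by
  obtain ⟨m, rfl⟩ := Nat.exists_eq_add_of_le' hn
  have e : {R : ColoredRibbon (m + 1) r // R.IsCycloribbon} ≃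
      Σ c : Fin (m + 1) → Fin r, {b : Fin (m + 1 - 1) → Bool // ∀ i, b i ∈ allowed c i} :=
    ((ribbonEquiv (m + 1) r).subtypeEquiv isCycloribbon_iff).trans
      (Equiv.subtypeProdEquivSigmaSubtype
        fun (c : Fin (m + 1) → Fin r) (b : Fin (m + 1 - 1) → Bool) => ∀ i, b i ∈ allowed c i)
  rw [Nat.card_congr e, Nat.card_eq_fintype_card, Fintype.card_sigma]
  change _ = r * (r + 1) ^ m
  rw [← sum_prod_ite_eq]
  refine sum_congr rfl fun c _ => ?_
  rw [Fintype.card_of_subtype (Fintype.piFinset (allowed c)) (fun b => Fintype.mem_piFinset),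
    Fintype.card_piFinset]
  exact prod_congr rfl fun i _ => card_allowed c i

/-- The class of the simple module attached to a cycloribbon. -/
noncomputable def cycloribbonClass {u : Fin r → ℂ} (hu : Function.Injective u)
    (R : {R : ColoredRibbon n r // R.IsCycloribbon}) : SimpleClass.{v} (H n u) :=
  -- The ideal lives in the lowest universe; lifting it places it among modules in universe `v`.
  Quotient.mk (simpleSetoid (H n u)) ⟨ModuleCat.of (H n u) (ULift.{v} (S u R.1)),
    have := isSimpleModule_S hu R.2
    IsSimpleModule.congr (N := S u R.1) (ULift.moduleEquiv : ULift.{v} (S u R.1) ≃ₗ[H n u] S u R.1)⟩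

theorem cycloribbonClass_bijective {u : Fin r → ℂ} (hu : Function.Injective u) :
    Function.Bijective (cycloribbonClass.{v} (n := n) hu) := by
  constructor
  · intro R R' h
    obtain ⟨e⟩ := Quotient.exact (s := simpleSetoid (H n u)) h
    exact Subtype.ext (eq_of_S_equiv hu R.2 R'.2
      ((ULift.moduleEquiv.symm.trans e).trans ULift.moduleEquiv))
  · intro q
    induction q using Quotient.inductionOn with
    | h M =>
      have := M.2
      obtain ⟨R, hR, ⟨e⟩⟩ := exists_equiv_S (n := n) (M := M.1) hu
      exact ⟨⟨R, hR⟩, Quotient.sound (s := simpleSetoid (H n u)) ⟨ULift.moduleEquiv.trans e.symm⟩⟩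

end AKS

theorem mainTheorem1 (n r : ℕ) (u : Fin r → ℂ) (hu : Function.Injective u) :
    (∀ R : AKS.ColoredRibbon n r, R.IsCycloribbon →
      IsSimpleModule (AKS.H n u) (AKS.S u R) ∧
      IsAtom (AKS.S u R) ∧
      Module.finrank ℂ (AKS.S u R) = 1 ∧
      (∀ j : Fin n, ∀ x ∈ AKS.S u R, AKS.ξ u j * x = u (R.color j) • x) ∧
      (∀ i : Fin (n - 1), ∀ x ∈ AKS.S u R,
        AKS.T u i * x = (if i ∈ AKS.descents R.phi.shape then (-1 : ℂ) else 0) • x)) ∧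
    (∀ R R' : AKS.ColoredRibbon n r, R.IsCycloribbon → R'.IsCycloribbon →
      Nonempty (AKS.S u R ≃ₗ[AKS.H n u] AKS.S u R') → R = R') ∧
    (∀ (M : Type v) [AddCommGroup M] [Module ℂ M] [Module (AKS.H n u) M]
      [IsScalarTower ℂ (AKS.H n u) M], IsSimpleModule (AKS.H n u) M →
      Module.finrank ℂ M = 1 ∧
      ∃ R : AKS.ColoredRibbon n r, R.IsCycloribbon ∧
        Nonempty (M ≃ₗ[AKS.H n u] AKS.S u R)) ∧
    (1 ≤ n → Nat.card (AKS.SimpleClass.{v} (AKS.H n u)) = r * (r + 1) ^ (n - 1)) := by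
  refine ⟨fun R hR => ⟨AKS.isSimpleModule_S hu hR,
    isSimpleModule_iff_isAtom.1 (AKS.isSimpleModule_S hu hR),
    (AKS.isEigen_gen hu hR).finrank_eq_one (AKS.gen_ne_zero hu R) (AKS.exists_smul_gen R),
    fun j x hx => ?_, fun i x hx => ?_⟩, fun R R' hR hR' ⟨e⟩ => AKS.eq_of_S_equiv hu hR hR' e,
    fun M _ _ _ _ hM => ⟨?_, AKS.exists_equiv_S hu⟩, fun hn => ?_⟩
  · obtain ⟨h, rfl⟩ := Submodule.mem_span_singleton.1 hx
    have e := ((AKS.isEigen_eta hu hR).smul h).ξ_smul j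
    rw [smul_eq_mul (AKS.ξ u j), smul_eq_mul (algebraMap _ _ _), ← Algebra.smul_def] at e
    exact e
  · obtain ⟨h, rfl⟩ := Submodule.mem_span_singleton.1 hx
    have e := ((AKS.isEigen_eta hu hR).smul h).T_smul i
    refine e.trans ?_
    split_ifs
    · exact (neg_one_smul ℂ (h • AKS.eta u R)).symm
    · exact (zero_smul ℂ (h • AKS.eta u R)).symm
  · have : Nontrivial M := IsSimpleModule.nontrivial (AKS.H n u) M
    obtain ⟨w, hw0, c, D, hw⟩ := AKS.exists_isEigen (n := n) (M := M) hu
    exact hw.finrank_eq_one hw0 (AKS.exists_smul_eq_of_isSimpleModule hw0)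
  · rw [← Nat.card_congr (Equiv.ofBijective _ (AKS.cycloribbonClass_bijective hu)),
      AKS.card_cycloribbon hn]
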